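/- Let $\mathrm{B}(\varepsilon)$ be the binary symmetric channel with crossover probability $\varepsilon$, and for $p_j\ge 0$ with $\sum_j p_j=1$ let $\sum_j p_j\mathrm{B}(\varepsilon_j)$ be the channel with uniform binary input that uses $\mathrm{B}(\varepsilon_j)$ with probability $p_j$ and reveals $j$ at the output. Binary-input discrete memoryless channels are considered up to equivalence $\cong$, i.e. equality of likelihood-ratio profiles ($P_W(\varepsilon)$, $\varepsilon\in[0,1]$, is the probability that the output $y$ of $W$ satisfies $\Pr(y|0)/\Pr(y|1)=\varepsilon/(1-\varepsilon)$). $I(W)$ denotes the symmetric capacity (the mutual information between the uniform input and the output, in bits). Let $2\le n<m$ and $Q\cong\sum_{i=1}^m q_i\mathrm{B}(\sigma_i)$ with $q_i>0$, $\sum_i q_i=1$ and $0\le\sigma_1<\cdots<\sigma_m\le 1/2$; put $q_0=q_{m+1}=0$. For $1\le i_2<\cdots<i_n\le m$ and $0\le s_j\le q_{i_j}$ ($2\le j\le n$), put $i_1=s_1=s_{n+1}=0$, $i_{n+1}=m+1$, and let $D_Q(i_2,\dots,i_n;s_2,\dots,s_n)=\sum_{j=1}^n p_j\mathrm{B}(\varepsilon_j)$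 with $$p_j=s_j+\sum_{i_j<i<i_{j+1}}q_i+(q_{i_{j+1}}-s_{j+1}),\qquad p_j\varepsilon_j=s_j\sigma_{i_j}+\sum_{i_j<i<i_{j+1}}q_i\sigma_i+(q_{i_{j+1}}-s_{j+1})\sigma_{i_{j+1}}$$ (the terms with $\sigma_0$ and $\sigma_{m+1}$ have coefficient $0$). The pairs $(i_j,s_j)$ are its splitting patterns. It is a *$2n$-$P^*$-degradation* of $Q$ if all $p_j>0$, $0\le\varepsilon_1<\cdots<\varepsilon_n\le 1/2$, and for every $j\in\{1,\dots,n\}$ with $i_{j+1}=i_j+1$: if $s_j=0$ then $s_{j+1}=0$, $p_j=q_{i_{j+1}}$ and $\varepsilon_j=\sigma_{i_{j+1}}$; if $s_{j+1}=q_{i_{j+1}}$ then $s_j=q_{i_j}$, $p_j=q_{i_j}$ and $\varepsilon_j=\sigma_{i_j}$. It is a *$2n$-$P^+$-degradation* if moreover $s_j\in\{0,q_{i_j}\}$ for $2\le j\le n$. For $1=k_0<k_1<\cdots<k_n=m+1$ let $D_Q^+(k_1,\dots,k_{n-1})=\sum_{j=1}^n p_j\mathrm{B}(\varepsilon_j)$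 with $p_j=\sum_{k_{j-1}\le i<k_j}q_i$ and $p_j\varepsilon_j=\sum_{k_{j-1}\le i<k_j}q_i\sigma_i$. The capacity-loss rate of $W$ is $(I(Q)-I(W))/I(Q)$. One $2n$-$P^*$-degradation is *better* than another if its capacity-loss rate is strictly smaller, and it is *C-optimal* if its capacity-loss rate is minimal among all $2n$-$P^*$-degradations of $Q$. Let $$\phi(\varepsilon,\varepsilon')=\frac{\ln\frac{1-\varepsilon}{1-\varepsilon'}}{\ln\frac{(1-\varepsilon)\varepsilon'}{(1-\varepsilon')\varepsilon}}\quad(0<\varepsilon<\varepsilon'\le 1/2),\qquad \phi(0,\varepsilon')=0 .$$ 1. Every C-optimal $2n$-degradation $W$ of $Q$ is a $2n$-$P^+$-degradation of $Q$; indeed, whenever $W\cong D_Q(i_2,\dots,i_n;s_2,\dots,s_n)$ is a representation of $W$ as a $2n$-$P^*$-degradation, then $s_j\in\{0,q_{i_j}\}$ for all $j=2,\dots,n$. 2. Let $W=D_Q^+(k_1,\dots,k_{n-1})=\sum_{j=1}^n p_j\mathrm{B}(\varepsilon_j)$ with $1=k_0<k_1<\cdots<k_n=m+1$, and let $1\le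 j\le n-1$. (a) If $\phi(\varepsilon_j,\varepsilon_{j+1})\ge\sigma_{k_j}$, then replacing $k_j$ by $k_j+1$ again gives a strictly increasing sequence from $1$ to $m+1$, and $D_Q^+$ of it is a $2n$-$P^+$-degradation of $Q$ that is better than $W$. (b) If $\phi(\varepsilon_j,\varepsilon_{j+1})\le\sigma_{k_j-1}$ and $\varepsilon_j+\sigma_{k_j-1}>0$, then the same holds for replacing $k_j$ by $k_j-1$. -/

import Mathlib

namespace SymBIDMC

/-- `W : ZMod 2 → Y → ℝ`, with `W x y = Pr(y | x)`, is a binary-input discrete memoryless channel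
with output alphabet `Y` (the input is uniform on `ZMod 2`). -/
structure IsBIDMC {Y : Type*} (W : ZMod 2 → Y → ℝ) : Prop where
  nonneg : ∀ x y, 0 ≤ W x y
  hasSum_one : ∀ x, HasSum (W x) 1

/-- The symmetric capacity `I(W)`, the mutual information of the uniform input and the output. -/
noncomputable def symmCapacity {Y : Type*} (W : ZMod 2 → Y → ℝ) : ℝ :=
  ∑' y, ∑ x : ZMod 2,
    (1 / 2 : ℝ) * W x y * Real.logb 2 (W x y / ((1 / 2 : ℝ) * W 0 y + (1 / 2 : ℝ) * W 1 y))

/-- The likelihood-ratio profile `P_W(ε)`: the probability that the output `y` has likelihood ratio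
`Pr(y | 0) / Pr(y | 1) = ε / (1 - ε)` (cross-multiplied, so that the ratio may be infinite;
outputs of probability zero contribute nothing). -/
noncomputable def lrProfile {Y : Type*} (W : ZMod 2 → Y → ℝ) (ε : ℝ) : ℝ :=
  ∑' y : {y : Y // W 0 y * (1 - ε) = W 1 y * ε}, (W 0 y + W 1 y) / 2

/-- Equivalence `W ≅ W'` of channels: the likelihood-ratio profiles coincide on `[0, 1]`. -/
def ChannelEquiv {Y Y' : Type*} (W : ZMod 2 → Y → ℝ) (W' : ZMod 2 → Y' → ℝ) : Prop :=
  ∀ ε ∈ Set.Icc (0 : ℝ) 1, lrProfile W ε = lrProfile W' ε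

/-- The binary symmetric channel `B(ε)`. -/
noncomputable def bsc (ε : ℝ) : ZMod 2 → ZMod 2 → ℝ :=
  fun x y => if y = x then 1 - ε else ε

/-- The random switching channel `∑_{j ∈ [n]} p_j B(ε_j)`; the families `p`, `ε` are indexed
from `1` to `n`. -/
noncomputable def bscMixture (n : ℕ) (p ε : ℕ → ℝ) : ZMod 2 → Fin n × ZMod 2 → ℝ :=
  fun x y => p (y.1 + 1) * bsc (ε (y.1 + 1)) x y.2

/-- The data of a symmetric channel `∑_{i ∈ [m]} q_i B(σ_i)` in normal form, i.e. of a
member of `𝔹*_m`, with the convention `q_0 = q_{m+1} = 0`. -/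
structure IsNormalForm (m : ℕ) (q σ : ℕ → ℝ) : Prop where
  q_zero : q 0 = 0
  q_last : q (m + 1) = 0
  q_pos : ∀ i ∈ Finset.Icc 1 m, 0 < q i
  q_sum : ∑ i ∈ Finset.Icc 1 m, q i = 1
  σ_nonneg : ∀ i ∈ Finset.Icc 1 m, 0 ≤ σ i
  σ_lt : ∀ i i', 1 ≤ i → i < i' → i' ≤ m → σ i < σ i'
  σ_le : ∀ i ∈ Finset.Icc 1 m, σ i ≤ 1 / 2

/-- The weight `r_l`, `a ≤ l ≤ b`, of `B(σ_l)` in the `(a, b; t, t')`-segment of the mixture. -/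
noncomputable def segCoeff (q : ℕ → ℝ) (a b : ℕ) (t t' : ℝ) (l : ℕ) : ℝ :=
  if l = a then t else if l = b then q b - t' else q l

/-- The weight `p_j` of the particle compounded from the `j`-th segment
`(i_j, i_{j+1}; s_j, s_{j+1})`. -/
noncomputable def segWeight (q : ℕ → ℝ) (i : ℕ → ℕ) (s : ℕ → ℝ) (j : ℕ) : ℝ :=
  ∑ l ∈ Finset.Icc (i j) (i (j + 1)), segCoeff q (i j) (i (j + 1)) (s j) (s (j + 1)) l

/-- The crossover probability `ε_j` of the particle compounded from the `j`-th segment. -/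
noncomputable def segMean (q σ : ℕ → ℝ) (i : ℕ → ℕ) (s : ℕ → ℝ) (j : ℕ) : ℝ :=
  (∑ l ∈ Finset.Icc (i j) (i (j + 1)),
    segCoeff q (i j) (i (j + 1)) (s j) (s (j + 1)) l * σ l) / segWeight q i s j

/-- The channel `D_Q(i_2, …, i_n; s_2, …, s_n) = ∑_{j ∈ [n]} p_j B(ε_j)`. -/
noncomputable def segChannel (n : ℕ) (q σ : ℕ → ℝ) (i : ℕ → ℕ) (s : ℕ → ℝ) :
    ZMod 2 → Fin n × ZMod 2 → ℝ :=
  bscMixture n (segWeight q i s) (segMean q σ i s)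

/-- The splitting patterns `(i_2, s_2), …, (i_n, s_n)`, extended by `i_1 = s_1 = 0`,
`i_{n+1} = m + 1`, `s_{n+1} = 0`, define a `2n`-`P*`-degradation
`D_Q(i_2, …, i_n; s_2, …, s_n)` of `Q = ∑ q_i B(σ_i)`. -/
structure IsPStarPattern (m n : ℕ) (q σ : ℕ → ℝ) (i : ℕ → ℕ) (s : ℕ → ℝ) : Prop where
  i_one : i 1 = 0
  s_one : s 1 = 0
  i_last : i (n + 1) = m + 1
  s_last : s (n + 1) = 0
  i_lt : ∀ j ∈ Finset.Icc 1 n, i j < i (j + 1)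
  s_nonneg : ∀ j ∈ Finset.Icc 2 n, 0 ≤ s j
  s_le : ∀ j ∈ Finset.Icc 2 n, s j ≤ q (i j)
  weight_pos : ∀ j ∈ Finset.Icc 1 n, 0 < segWeight q i s j
  mean_nonneg : 0 ≤ segMean q σ i s 1
  mean_lt : ∀ j ∈ Finset.Ico 1 n, segMean q σ i s j < segMean q σ i s (j + 1)
  mean_le : segMean q σ i s n ≤ 1 / 2
  adjacent_left : ∀ j ∈ Finset.Icc 1 n, i (j + 1) = i j + 1 → s j = 0 →
    s (j + 1) = 0 ∧ segWeight q i s j = q (i (j + 1)) ∧ segMean q σ i s j = σ (i (j + 1))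
  adjacent_right : ∀ j ∈ Finset.Icc 1 n, i (j + 1) = i j + 1 → s (j + 1) = q (i (j + 1)) →
    s j = q (i j) ∧ segWeight q i s j = q (i j) ∧ segMean q σ i s j = σ (i j)

/-- `W` is (a channel equivalent to) a `2n`-`P*`-degradation of `∑_{i ∈ [m]} q_i B(σ_i)`. -/
def IsPStarDegradation (m n : ℕ) (q σ : ℕ → ℝ) {Y : Type*} (W : ZMod 2 → Y → ℝ) : Prop :=
  IsBIDMC W ∧ ∃ (i : ℕ → ℕ) (s : ℕ → ℝ),
    IsPStarPattern m n q σ i s ∧ ChannelEquiv W (segChannel n q σ i s)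

/-- `W` is (a channel equivalent to) a `2n`-`P⁺`-degradation of `∑_{i ∈ [m]} q_i B(σ_i)`: a
`2n`-`P*`-degradation whose splitting patterns have `s_j ∈ {0, q_{i_j}}`. -/
def IsPPlusDegradation (m n : ℕ) (q σ : ℕ → ℝ) {Y : Type*} (W : ZMod 2 → Y → ℝ) : Prop :=
  IsBIDMC W ∧ ∃ (i : ℕ → ℕ) (s : ℕ → ℝ),
    IsPStarPattern m n q σ i s ∧ (∀ j ∈ Finset.Icc 2 n, s j = 0 ∨ s j = q (i j)) ∧
      ChannelEquiv W (segChannel n q σ i s)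

/-- The capacity-loss rate `(I(Q) - I(W)) / I(Q)`. -/
noncomputable def clr {X Y : Type*} (Q : ZMod 2 → X → ℝ) (W : ZMod 2 → Y → ℝ) : ℝ :=
  (symmCapacity Q - symmCapacity W) / symmCapacity Q

/-- `W'` is a better `2n`-`P*`-degradation of `Q ≅ ∑_{i ∈ [m]} q_i B(σ_i)` than `W`. -/
def IsBetter (m n : ℕ) (q σ : ℕ → ℝ) {X Y Y' : Type*} (Q : ZMod 2 → X → ℝ)
    (W' : ZMod 2 → Y' → ℝ) (W : ZMod 2 → Y → ℝ) : Prop :=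
  IsPStarDegradation m n q σ W' ∧ IsPStarDegradation m n q σ W ∧ clr Q W' < clr Q W

/-- `W` is a C-optimal `2n`-degradation of `Q ≅ ∑_{i ∈ [m]} q_i B(σ_i)`: its capacity-loss rate
is minimal among the `2n`-`P*`-degradations. -/
def IsCOptimal (m n : ℕ) (q σ : ℕ → ℝ) {X Y : Type*} (Q : ZMod 2 → X → ℝ)
    (W : ZMod 2 → Y → ℝ) : Prop :=
  IsPStarDegradation m n q σ W ∧
    ∀ (Y' : Type) (W' : ZMod 2 → Y' → ℝ), IsPStarDegradation m n q σ W' → clr Q W ≤ clr Q W'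

/-- `1 = k_0 < k_1 < ⋯ < k_n = m + 1`. -/
structure IsCutSequence (m n : ℕ) (k : ℕ → ℕ) : Prop where
  zero : k 0 = 1
  last : k n = m + 1
  lt : ∀ j ∈ Finset.Icc 1 n, k (j - 1) < k j

/-- The weight `p_j` of the particle compounded from `q_i B(σ_i)`, `k_{j-1} ≤ i < k_j`. -/
noncomputable def blockWeight (q : ℕ → ℝ) (k : ℕ → ℕ) (j : ℕ) : ℝ :=
  ∑ i ∈ Finset.Ico (k (j - 1)) (k j), q i

/-- The crossover probability `ε_j` of the particle compounded from `q_i B(σ_i)`,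
`k_{j-1} ≤ i < k_j`. -/
noncomputable def blockMean (q σ : ℕ → ℝ) (k : ℕ → ℕ) (j : ℕ) : ℝ :=
  (∑ i ∈ Finset.Ico (k (j - 1)) (k j), q i * σ i) / blockWeight q k j

/-- The channel `D⁺_Q(k_1, …, k_{n-1}) = ∑_{j ∈ [n]} p_j B(ε_j)`. -/
noncomputable def blockChannel (n : ℕ) (q σ : ℕ → ℝ) (k : ℕ → ℕ) :
    ZMod 2 → Fin n × ZMod 2 → ℝ :=
  bscMixture n (blockWeight q k) (blockMean q σ k)

/-- `φ(ε₁, ε₂) = ln((1-ε₁)/(1-ε₂)) / ln((1-ε₁)ε₂ / ((1-ε₂)ε₁))`. At `ε₁ = 0` Lean's conventions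
give the value `0`, which is the limit as `ε₁` tends to `0` from the right. -/
noncomputable def phi (ε₁ ε₂ : ℝ) : ℝ :=
  Real.log ((1 - ε₁) / (1 - ε₂)) / Real.log (((1 - ε₁) * ε₂) / ((1 - ε₂) * ε₁))

end SymBIDMC

/-!
The symmetric capacity depends only on the likelihood-ratio profile, and it is
`∑ p_j (1 - h(ε_j))` for the channel `∑ p_j B(ε_j)`, where `h` is the binary entropy in bits.
By strict concavity of `h`, moving a weight `t` of `B(τ)` from the particle `j + 1` to the particle
`j` changes `∑ p_j h(ε_j)` by strictly less than the first-order value `t (T_j(τ) - T_{j+1}(τ))`,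
where `T_j` is the tangent to `h` at `ε_j`; so the capacity increases as soon as this value is
nonpositive. A fractional splitting weight `s_j` can be perturbed in both directions, hence with
either sign of `t`, and is never optimal. For the `P⁺`-degradations a whole particle is moved across
a cut; `φ(ε_j, ε_{j+1})` is the abscissa at which the two tangents cross, and so comparing it with
`τ` decides the sign.
-/

namespace SymBIDMC

/-! ### Symmetric capacity and likelihood-ratio profiles -/

section BSCCapacity
variable {ε : ℝ}

/-- The capacity `1 - h(ε)` of the binary symmetric channel `B(ε)`, in bits. Mathlib's
`Real.binEntropy` is in nats, hence the division by `log 2`. -/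
noncomputable def bscCapacity (ε : ℝ) : ℝ := 1 - Real.binEntropy ε / Real.log 2

theorem bscCapacity_one_sub (ε : ℝ) : bscCapacity (1 - ε) = bscCapacity ε := by
  rw [bscCapacity, bscCapacity, Real.binEntropy_one_sub]

theorem bscCapacity_nonneg (ε : ℝ) : 0 ≤ bscCapacity ε :=
  sub_nonneg.2 <| div_le_one_of_le₀ Real.binEntropy_le_log_two (Real.log_nonneg one_le_two)

theorem bscCapacity_pos (hε : ε ≠ 1 / 2) : 0 < bscCapacity ε := by
  rw [bscCapacity, sub_pos, div_lt_one (Real.log_pos one_lt_two), Real.binEntropy_lt_log_two]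
  rwa [inv_eq_one_div]

theorem bscCapacity_le_one (hε : ε ∈ Set.Icc (0 : ℝ) 1) : bscCapacity ε ≤ 1 :=
  sub_le_self 1 <| div_nonneg (Real.binEntropy_nonneg hε.1 hε.2) (Real.log_nonneg one_le_two)

theorem bscCapacity_eq_logb (ε : ℝ) :
    bscCapacity ε = ε * Real.logb 2 (2 * ε) + (1 - ε) * Real.logb 2 (2 * (1 - ε)) := by
  have h2 : Real.log 2 ≠ 0 := (Real.log_pos one_lt_two).ne'
  have mul_logb_two_mul (x : ℝ) :
      x * Real.logb 2 (2 * x) = x - Real.negMulLog x / Real.log 2 := by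
    rcases eq_or_ne x 0 with rfl | hx
    · simp
    · rw [Real.logb, Real.log_mul two_ne_zero hx, Real.negMulLog]
      field_simp
      ring
  rw [bscCapacity, Real.binEntropy_eq_negMulLog_add_negMulLog_one_sub, mul_logb_two_mul,
    mul_logb_two_mul]
  ring

end BSCCapacity

section Profile
variable {Y : Type*} {W : ZMod 2 → Y → ℝ}

/-- The probability of the output `y` of the channel `W` under the uniform input. -/
noncomputable def outputProb (W : ZMod 2 → Y → ℝ) (y : Y) : ℝ := (W 0 y + W 1 y) / 2

/-- The posterior probability of the input `0` given the output `y`. An output of probability zero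
gets the value `0 / 0 = 0`. -/
noncomputable def posterior (W : ZMod 2 → Y → ℝ) (y : Y) : ℝ := W 0 y / (W 0 y + W 1 y)

theorem IsBIDMC.outputProb_nonneg (hW : IsBIDMC W) (y : Y) : 0 ≤ outputProb W y :=
  div_nonneg (add_nonneg (hW.nonneg 0 y) (hW.nonneg 1 y)) zero_le_two

theorem IsBIDMC.summable_outputProb (hW : IsBIDMC W) : Summable (outputProb W) :=
  ((hW.hasSum_one 0).summable.add (hW.hasSum_one 1).summable).div_const 2

theorem IsBIDMC.posterior_mem_Icc (hW : IsBIDMC W) (y : Y) :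
    posterior W y ∈ Set.Icc (0 : ℝ) 1 := by
  have h0 := hW.nonneg 0 y
  have h1 := hW.nonneg 1 y
  exact ⟨div_nonneg h0 (add_nonneg h0 h1),
    div_le_one_of_le₀ (le_add_of_nonneg_right h1) (add_nonneg h0 h1)⟩

theorem IsBIDMC.symmCapacity_eq_tsum (hW : IsBIDMC W) :
    symmCapacity W = ∑' y, outputProb W y * bscCapacity (posterior W y) := by
  refine tsum_congr fun y => (Fin.sum_univ_two _).trans ?_
  change 1 / 2 * W 0 y * Real.logb 2 (W 0 y / (1 / 2 * W 0 y + 1 / 2 * W 1 y)) +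
    1 / 2 * W 1 y * Real.logb 2 (W 1 y / (1 / 2 * W 0 y + 1 / 2 * W 1 y)) = _
  have h0 := hW.nonneg 0 y
  have h1 := hW.nonneg 1 y
  by_cases hy : W 0 y + W 1 y = 0
  · obtain ⟨h0, h1⟩ := (add_eq_zero_iff_of_nonneg h0 h1).1 hy
    simp [outputProb, h0, h1]
  have hlr0 : W 0 y / (1 / 2 * W 0 y + 1 / 2 * W 1 y) = 2 * posterior W y := by
    rw [posterior]
    field_simp
  have hlr1 : W 1 y / (1 / 2 * W 0 y + 1 / 2 * W 1 y) = 2 * (1 - posterior W y) := by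
    rw [posterior]
    field_simp
    ring
  rw [hlr0, hlr1, bscCapacity_eq_logb, outputProb, posterior]
  field_simp
  ring

theorem lrProfile_eq_tsum_preimage (W : ZMod 2 → Y → ℝ) (ε : ℝ) :
    lrProfile W ε = ∑' y : posterior W ⁻¹' {ε}, outputProb W y := by
  classical
  change ∑' y : {y | W 0 y * (1 - ε) = W 1 y * ε}, outputProb W y = _
  rw [tsum_subtype, tsum_subtype]
  refine tsum_congr fun y => ?_
  by_cases hy : W 0 y + W 1 y = 0
  · simp [Set.indicator_apply, outputProb, hy]
  · have hiff : W 0 y * (1 - ε) = W 1 y * ε ↔ posterior W y = ε := by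
      rw [posterior, div_eq_iff hy]
      constructor <;> intro h <;> linarith
    simp only [Set.indicator_apply, Set.mem_ofPred_eq, Set.mem_preimage, Set.mem_singleton_iff,
      hiff]

theorem IsBIDMC.lrProfile_eq_zero (hW : IsBIDMC W) {ε : ℝ} (hε : ε ∉ Set.Icc (0 : ℝ) 1) :
    lrProfile W ε = 0 := by
  have : IsEmpty (posterior W ⁻¹' {ε}) := ⟨fun ⟨y, hy⟩ => hε (hy ▸ hW.posterior_mem_Icc y)⟩
  rw [lrProfile_eq_tsum_preimage, tsum_empty]

theorem IsBIDMC.symmCapacity_eq_tsum_lrProfile (hW : IsBIDMC W) :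
    symmCapacity W = ∑' ε, lrProfile W ε * bscCapacity ε := by
  have hsum : Summable fun y => outputProb W y * bscCapacity (posterior W y) :=
    hW.summable_outputProb.of_nonneg_of_le
      (fun y => mul_nonneg (hW.outputProb_nonneg y) (bscCapacity_nonneg _))
      fun y => mul_le_of_le_one_right (hW.outputProb_nonneg y)
        (bscCapacity_le_one (hW.posterior_mem_Icc y))
  rw [hW.symmCapacity_eq_tsum, ← (hsum.hasSum.tsum_fiberwise (posterior W)).tsum_eq]
  refine tsum_congr fun ε => ?_
  rw [lrProfile_eq_tsum_preimage, ← tsum_mul_right]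
  exact tsum_congr fun ⟨y, hy⟩ => by rw [Set.mem_singleton_iff.1 hy]

end Profile

theorem ChannelEquiv.refl {Y : Type*} (W : ZMod 2 → Y → ℝ) : ChannelEquiv W W := fun _ _ => rfl

theorem ChannelEquiv.symmCapacity_eq {Y Y' : Type*} {W : ZMod 2 → Y → ℝ} {W' : ZMod 2 → Y' → ℝ}
    (h : ChannelEquiv W W') (hW : IsBIDMC W) (hW' : IsBIDMC W') :
    symmCapacity W = symmCapacity W' := by
  rw [hW.symmCapacity_eq_tsum_lrProfile, hW'.symmCapacity_eq_tsum_lrProfile]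
  refine tsum_congr fun ε => ?_
  by_cases hε : ε ∈ Set.Icc (0 : ℝ) 1
  · rw [h ε hε]
  · rw [hW.lrProfile_eq_zero hε, hW'.lrProfile_eq_zero hε]

theorem clr_lt_clr_iff {X Y Y' : Type*} {Q : ZMod 2 → X → ℝ} (hQ : 0 < symmCapacity Q)
    {W : ZMod 2 → Y → ℝ} {W' : ZMod 2 → Y' → ℝ} :
    clr Q W' < clr Q W ↔ symmCapacity W < symmCapacity W' := by
  rw [clr, clr, div_lt_div_iff_of_pos_right hQ, sub_lt_sub_iff_left]

/-! ### Mixtures of binary symmetric channels -/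

theorem bsc_comm (ε : ℝ) (x y : ZMod 2) : bsc ε x y = bsc ε y x := by
  simp only [bsc, eq_comm]

theorem bsc_add_bsc (ε : ℝ) (y : ZMod 2) : bsc ε 0 y + bsc ε 1 y = 1 := by
  have zero_or_one : ∀ y : ZMod 2, y = 0 ∨ y = 1 := by decide
  obtain rfl | rfl := zero_or_one y <;> simp [bsc]

theorem bscCapacity_bsc (ε : ℝ) (x y : ZMod 2) : bscCapacity (bsc ε x y) = bscCapacity ε := by
  unfold bsc
  split_ifs
  · exact bscCapacity_one_sub ε
  · rfl

theorem bsc_nonneg {ε : ℝ} (hε : ε ∈ Set.Icc (0 : ℝ) 1) (x y : ZMod 2) : 0 ≤ bsc ε x y := by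
  unfold bsc
  split_ifs
  · exact sub_nonneg.2 hε.2
  · exact hε.1

theorem sum_fin_add_one_eq_sum_Icc {M : Type*} [AddCommMonoid M] (n : ℕ) (f : ℕ → M) :
    ∑ j : Fin n, f (j + 1) = ∑ j ∈ Finset.Icc 1 n, f j := by
  rw [Fin.sum_univ_eq_sum_range (fun j => f (j + 1)), Finset.range_eq_Ico,
    Finset.sum_Ico_add' f 0 n 1]
  rfl

/-- The parameters `p`, `ε`, indexed from `1` to `n`, for which `∑_{j ∈ [n]} p_j B(ε_j)` is a
channel. -/
structure IsBSCMixture (n : ℕ) (p ε : ℕ → ℝ) : Prop where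
  weight_nonneg : ∀ j ∈ Finset.Icc 1 n, 0 ≤ p j
  crossover_mem : ∀ j ∈ Finset.Icc 1 n, ε j ∈ Set.Icc (0 : ℝ) 1
  sum_weight : ∑ j ∈ Finset.Icc 1 n, p j = 1

section Mixture
variable {n : ℕ} {p ε p' ε' : ℕ → ℝ}

theorem bscMixture_congr (hp : ∀ j ∈ Finset.Icc 1 n, p j = p' j)
    (hε : ∀ j ∈ Finset.Icc 1 n, ε j = ε' j) : bscMixture n p ε = bscMixture n p' ε' := by
  funext x ⟨j, y⟩
  have hj : (j : ℕ) + 1 ∈ Finset.Icc 1 n := Finset.mem_Icc.2 ⟨by omega, j.2⟩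
  simp only [bscMixture, hp _ hj, hε _ hj]

theorem IsBSCMixture.isBIDMC (h : IsBSCMixture n p ε) : IsBIDMC (bscMixture n p ε) where
  nonneg x y := by
    have hj : (y.1 : ℕ) + 1 ∈ Finset.Icc 1 n := Finset.mem_Icc.2 ⟨by omega, y.1.2⟩
    exact mul_nonneg (h.weight_nonneg _ hj) (bsc_nonneg (h.crossover_mem _ hj) x y.2)
  hasSum_one x := by
    have row_sum (j : Fin n) : ∑ y : ZMod 2, bscMixture n p ε x (j, y) = p (j + 1) := by
      refine (Fin.sum_univ_two _).trans ?_
      change p (j + 1) * bsc _ x 0 + p (j + 1) * bsc _ x 1 = _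
      rw [bsc_comm, bsc_comm _ x 1, ← mul_add, bsc_add_bsc, mul_one]
    have total : ∑ y, bscMixture n p ε x y = 1 := by
      rw [Fintype.sum_prod_type, Finset.sum_congr rfl fun j _ => row_sum j,
        sum_fin_add_one_eq_sum_Icc, h.sum_weight]
    exact total ▸ hasSum_fintype _

theorem outputProb_bscMixture (j : Fin n) (y : ZMod 2) :
    outputProb (bscMixture n p ε) (j, y) = p (j + 1) / 2 := by
  simp only [outputProb, bscMixture]
  rw [← mul_add, bsc_add_bsc, mul_one]

theorem posterior_bscMixture {j : Fin n} (hp : p (j + 1) ≠ 0) (y : ZMod 2) :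
    posterior (bscMixture n p ε) (j, y) = bsc (ε (j + 1)) 0 y := by
  simp only [posterior, bscMixture]
  rw [← mul_add, bsc_add_bsc, mul_one, mul_div_cancel_left₀ _ hp]

theorem IsBSCMixture.symmCapacity_eq (h : IsBSCMixture n p ε) :
    symmCapacity (bscMixture n p ε) = ∑ j ∈ Finset.Icc 1 n, p j * bscCapacity (ε j) := by
  have hterm (j : Fin n) (y : ZMod 2) : outputProb (bscMixture n p ε) (j, y) *
      bscCapacity (posterior (bscMixture n p ε) (j, y)) =
        p (j + 1) / 2 * bscCapacity (ε (j + 1)) := by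
    rw [outputProb_bscMixture]
    by_cases hp : p (j + 1) = 0
    · simp [hp]
    · rw [posterior_bscMixture hp, bscCapacity_bsc]
  rw [h.isBIDMC.symmCapacity_eq_tsum, tsum_fintype, Fintype.sum_prod_type,
    ← sum_fin_add_one_eq_sum_Icc]
  refine Finset.sum_congr rfl fun j _ => ?_
  rw [Finset.sum_congr rfl fun y _ => hterm j y, Finset.sum_const, Finset.card_univ, ZMod.card,
    nsmul_eq_mul]
  push_cast
  ring

end Mixture

namespace IsNormalForm
variable {m : ℕ} {q σ : ℕ → ℝ}

theorem strictMonoOn (hN : IsNormalForm m q σ) : StrictMonoOn σ (Set.Icc 1 m) :=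
  fun l hl l' hl' hlt => hN.σ_lt l l' hl.1 hlt hl'.2

theorem mem_Icc (hN : IsNormalForm m q σ) {l : ℕ} (hl : l ∈ Finset.Icc 1 m) :
    σ l ∈ Set.Icc (0 : ℝ) (1 / 2) :=
  ⟨hN.σ_nonneg l hl, hN.σ_le l hl⟩

theorem pos (hN : IsNormalForm m q σ) {l : ℕ} (hl : l ∈ Finset.Ioc 1 m) : 0 < σ l := by
  rw [Finset.mem_Ioc] at hl
  exact (hN.σ_nonneg 1 (Finset.mem_Icc.2 (by omega))).trans_lt (hN.σ_lt 1 l le_rfl hl.1 hl.2)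

theorem eq_zero (hN : IsNormalForm m q σ) {l : ℕ} (hl : l ≤ m + 1) (hlm : l ∉ Finset.Icc 1 m) :
    q l = 0 := by
  rw [Finset.mem_Icc] at hlm
  obtain rfl | rfl : l = 0 ∨ l = m + 1 := by omega
  · exact hN.q_zero
  · exact hN.q_last

theorem nonneg (hN : IsNormalForm m q σ) {l : ℕ} (hl : l ≤ m + 1) : 0 ≤ q l := by
  by_cases hlm : l ∈ Finset.Icc 1 m
  · exact (hN.q_pos l hlm).le
  · exact (hN.eq_zero hl hlm).ge

theorem isBSCMixture (hN : IsNormalForm m q σ) : IsBSCMixture m q σ where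
  weight_nonneg j hj := (hN.q_pos j hj).le
  crossover_mem _ hj := Set.Icc_subset_Icc_right (by norm_num) (hN.mem_Icc hj)
  sum_weight := hN.q_sum

theorem symmCapacity_pos (hN : IsNormalForm m q σ) (hm : 2 ≤ m) :
    0 < symmCapacity (bscMixture m q σ) := by
  rw [hN.isBSCMixture.symmCapacity_eq]
  have h1 : 1 ∈ Finset.Icc 1 m := Finset.mem_Icc.2 (by omega)
  have hσ : σ 1 < 1 / 2 :=
    (hN.σ_lt 1 2 le_rfl one_lt_two hm).trans_le (hN.σ_le 2 (Finset.mem_Icc.2 (by omega)))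
  exact Finset.sum_pos' (fun j hj => mul_nonneg (hN.q_pos j hj).le (bscCapacity_nonneg _))
    ⟨1, h1, mul_pos (hN.q_pos 1 h1) (bscCapacity_pos hσ.ne)⟩

end IsNormalForm

/-! ### Moving mass between two particles -/

theorem mul_log_sub_mul_log_lt {x y : ℝ} (hx : 0 < x) (hy : 0 ≤ y) (hne : x ≠ y) :
    y * Real.log x - y * Real.log y < x - y := by
  rcases hy.eq_or_lt with rfl | hy
  · simpa using hx
  have hlog := Real.log_lt_sub_one_of_pos (div_pos hx hy) (by rwa [Ne, div_eq_one_iff_eq hy.ne'])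
  rw [Real.log_div hx.ne' hy.ne'] at hlog
  calc y * Real.log x - y * Real.log y = y * (Real.log x - Real.log y) := by ring
    _ < y * (x / y - 1) := mul_lt_mul_of_pos_left hlog hy
    _ = x - y := by field_simp

/-- The tangent to the binary entropy at `x`, evaluated at `y`; it is the cross entropy of
`(y, 1 - y)` relative to `(x, 1 - x)`. -/
noncomputable def entropyTangent (x y : ℝ) : ℝ :=
  -(y * Real.log x + (1 - y) * Real.log (1 - x))

theorem entropyTangent_self (x : ℝ) : entropyTangent x x = Real.binEntropy x := by
  simp only [entropyTangent, Real.binEntropy_eq_negMulLog_add_negMulLog_one_sub, Real.negMulLog]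
  ring

section Tangent
variable {x y : ℝ}

theorem binEntropy_lt_entropyTangent (hx : x ∈ Set.Ioo (0 : ℝ) 1) (hy : y ∈ Set.Icc (0 : ℝ) 1)
    (hne : x ≠ y) : Real.binEntropy y < entropyTangent x y := by
  have h0 := mul_log_sub_mul_log_lt hx.1 hy.1 hne
  have h1 := mul_log_sub_mul_log_lt (sub_pos.2 hx.2) (sub_nonneg.2 hy.2) (by simpa using hne)
  simp only [entropyTangent, Real.binEntropy_eq_negMulLog_add_negMulLog_one_sub, Real.negMulLog]
  linarith

theorem binEntropy_le_entropyTangent (hx : x ∈ Set.Ioo (0 : ℝ) 1) (hy : y ∈ Set.Icc (0 : ℝ) 1) :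
    Real.binEntropy y ≤ entropyTangent x y := by
  rcases eq_or_ne x y with rfl | hne
  · exact (entropyTangent_self x).ge
  · exact (binEntropy_lt_entropyTangent hx hy hne).le

end Tangent

section Absorb
variable {p ε t τ p' ε' : ℝ}

theorem mul_entropyTangent_of_moment (x : ℝ) (hw : p' = p + t) (hm : p' * ε' = p * ε + t * τ) :
    p' * entropyTangent x ε' = p * entropyTangent x ε + t * entropyTangent x τ := by
  simp only [entropyTangent]
  linear_combination (Real.log (1 - x) - Real.log x) * hm - Real.log (1 - x) * hw

theorem mul_binEntropy_le_of_moment (hε : ε ∈ Set.Ioo (0 : ℝ) 1) (hε' : ε' ∈ Set.Icc (0 : ℝ) 1)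
    (hp' : 0 ≤ p') (hw : p' = p + t) (hm : p' * ε' = p * ε + t * τ) :
    p' * Real.binEntropy ε' ≤ p * Real.binEntropy ε + t * entropyTangent ε τ := by
  rw [← entropyTangent_self ε, ← mul_entropyTangent_of_moment ε hw hm]
  exact mul_le_mul_of_nonneg_left (binEntropy_le_entropyTangent hε hε') hp'

theorem mul_binEntropy_lt_of_moment (hε : ε ∈ Set.Ioo (0 : ℝ) 1) (hε' : ε' ∈ Set.Icc (0 : ℝ) 1)
    (hp' : 0 ≤ p') (hw : p' = p + t) (hm : p' * ε' = p * ε + t * τ) (ht : t ≠ 0) (hτ : τ ≠ ε) :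
    p' * Real.binEntropy ε' < p * Real.binEntropy ε + t * entropyTangent ε τ := by
  have hshift : p' * (ε' - ε) ≠ 0 := by
    have : p' * (ε' - ε) = t * (τ - ε) := by linear_combination hm - ε * hw
    rw [this]
    exact mul_ne_zero ht (sub_ne_zero.2 hτ)
  have hpos : 0 < p' := hp'.lt_of_ne' (left_ne_zero_of_mul hshift)
  have hne : ε ≠ ε' := (sub_ne_zero.1 (right_ne_zero_of_mul hshift)).symm
  rw [← entropyTangent_self ε, ← mul_entropyTangent_of_moment ε hw hm]
  exact mul_lt_mul_of_pos_left (binEntropy_lt_entropyTangent hε hε' hne) hpos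

end Absorb

/-- `∑ p'_l B(ε'_l)` arises from `∑ p_l B(ε_l)` by moving weight `t` of `B(τ)` from the particle
`j + 1` to the particle `j`; `t` may be negative. -/
structure IsTransfer (p ε p' ε' : ℕ → ℝ) (j : ℕ) (t τ : ℝ) : Prop where
  weight_left : p' j = p j + t
  weight_right : p' (j + 1) = p (j + 1) - t
  moment_left : p' j * ε' j = p j * ε j + t * τ
  moment_right : p' (j + 1) * ε' (j + 1) = p (j + 1) * ε (j + 1) - t * τ
  weight_of_ne : ∀ l, l ≠ j → l ≠ j + 1 → p' l = p l
  crossover_of_ne : ∀ l, l ≠ j → l ≠ j + 1 → ε' l = ε l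

namespace IsTransfer
variable {n : ℕ} {p ε p' ε' : ℕ → ℝ} {j : ℕ} {t τ : ℝ}

theorem mul_binEntropy_add_lt (h : IsTransfer p ε p' ε' j t τ) (hp₁ : 0 ≤ p' j)
    (hp₂ : 0 ≤ p' (j + 1)) (hε₁' : ε' j ∈ Set.Icc (0 : ℝ) 1)
    (hε₂' : ε' (j + 1) ∈ Set.Icc (0 : ℝ) 1) (hε₁ : ε j ∈ Set.Ioo (0 : ℝ) 1)
    (hε₂ : ε (j + 1) ∈ Set.Ioo (0 : ℝ) 1) (hne : ε j ≠ ε (j + 1)) (ht : t ≠ 0)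
    (hslope : t * entropyTangent (ε j) τ ≤ t * entropyTangent (ε (j + 1)) τ) :
    p' j * Real.binEntropy (ε' j) + p' (j + 1) * Real.binEntropy (ε' (j + 1)) <
      p j * Real.binEntropy (ε j) + p (j + 1) * Real.binEntropy (ε (j + 1)) := by
  have hw₂ : p' (j + 1) = p (j + 1) + -t := by rw [h.weight_right, sub_eq_add_neg]
  have hm₂ : p' (j + 1) * ε' (j + 1) = p (j + 1) * ε (j + 1) + -t * τ := by
    rw [h.moment_right, neg_mul, sub_eq_add_neg]
  by_cases hτ : τ = ε j
  · have hle := mul_binEntropy_le_of_moment hε₁ hε₁' hp₁ h.weight_left h.moment_left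
    have hlt := mul_binEntropy_lt_of_moment hε₂ hε₂' hp₂ hw₂ hm₂ (neg_ne_zero.2 ht) (hτ ▸ hne)
    linarith
  · have hlt := mul_binEntropy_lt_of_moment hε₁ hε₁' hp₁ h.weight_left h.moment_left ht hτ
    have hle := mul_binEntropy_le_of_moment hε₂ hε₂' hp₂ hw₂ hm₂
    linarith

theorem symmCapacity_lt (h : IsTransfer p ε p' ε' j t τ) (hj : j ∈ Finset.Ico 1 n)
    (hB : IsBSCMixture n p ε) (hB' : IsBSCMixture n p' ε') (hε₁ : ε j ∈ Set.Ioo (0 : ℝ) 1)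
    (hε₂ : ε (j + 1) ∈ Set.Ioo (0 : ℝ) 1) (hne : ε j ≠ ε (j + 1)) (ht : t ≠ 0)
    (hslope : t * entropyTangent (ε j) τ ≤ t * entropyTangent (ε (j + 1)) τ) :
    symmCapacity (bscMixture n p ε) < symmCapacity (bscMixture n p' ε') := by
  rw [Finset.mem_Ico] at hj
  have hj₁ : j ∈ Finset.Icc 1 n := Finset.mem_Icc.2 (by omega)
  have hj₂ : j + 1 ∈ Finset.Icc 1 n := Finset.mem_Icc.2 (by omega)
  have hentropy := h.mul_binEntropy_add_lt (hB'.weight_nonneg j hj₁) (hB'.weight_nonneg _ hj₂)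
    (hB'.crossover_mem j hj₁) (hB'.crossover_mem _ hj₂) hε₁ hε₂ hne ht hslope
  rw [hB.symmCapacity_eq, hB'.symmCapacity_eq, ← sub_pos, ← Finset.sum_sub_distrib,
    Finset.sum_eq_add_of_mem j (j + 1) hj₁ hj₂ (by omega)]
  · calc 0 < (p j * Real.binEntropy (ε j) + p (j + 1) * Real.binEntropy (ε (j + 1)) -
          (p' j * Real.binEntropy (ε' j) + p' (j + 1) * Real.binEntropy (ε' (j + 1)))) /
            Real.log 2 := div_pos (sub_pos.2 hentropy) (Real.log_pos one_lt_two)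
      _ = _ := by
        simp only [bscCapacity]
        linear_combination -h.weight_left - h.weight_right
  · rintro l - ⟨hl₁, hl₂⟩
    rw [h.weight_of_ne l hl₁ hl₂, h.crossover_of_ne l hl₁ hl₂, sub_self]

end IsTransfer

/-! ### The crossing point of two entropy tangents -/

theorem phi_zero_left (b : ℝ) : phi 0 b = 0 := by simp [phi]

section Phi
variable {a b τ : ℝ}

theorem log_mul_div_mul_pos (ha : 0 < a) (hab : a < b) (hb : b < 1) :
    0 < Real.log (((1 - a) * b) / ((1 - b) * a)) := by
  have hb' : 0 < 1 - b := sub_pos.2 hb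
  refine Real.log_pos ((one_lt_div (mul_pos hb' ha)).2 ?_)
  exact mul_lt_mul'' (by linarith) hab hb'.le ha.le

theorem entropyTangent_sub_entropyTangent (ha : 0 < a) (hab : a < b) (hb : b < 1) (τ : ℝ) :
    entropyTangent b τ - entropyTangent a τ =
      (phi a b - τ) * Real.log (((1 - a) * b) / ((1 - b) * a)) := by
  have hb0 : b ≠ 0 := (ha.trans hab).ne'
  have ha1 : 1 - a ≠ 0 := (sub_pos.2 (hab.trans hb)).ne'
  have hb1 : 1 - b ≠ 0 := (sub_pos.2 hb).ne'
  rw [sub_mul, phi, div_mul_cancel₀ _ (log_mul_div_mul_pos ha hab hb).ne', Real.log_div ha1 hb1,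
    Real.log_div (mul_ne_zero ha1 hb0) (mul_ne_zero hb1 ha.ne'), Real.log_mul ha1 hb0,
    Real.log_mul hb1 ha.ne', entropyTangent, entropyTangent]
  ring

theorem le_phi_iff (ha : 0 < a) (hab : a < b) (hb : b < 1) :
    τ ≤ phi a b ↔ entropyTangent a τ ≤ entropyTangent b τ := by
  rw [← sub_nonneg, ← sub_nonneg (a := entropyTangent b τ),
    entropyTangent_sub_entropyTangent ha hab hb,
    mul_nonneg_iff_of_pos_right (log_mul_div_mul_pos ha hab hb)]

theorem phi_le_iff (ha : 0 < a) (hab : a < b) (hb : b < 1) :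
    phi a b ≤ τ ↔ entropyTangent b τ ≤ entropyTangent a τ := by
  rw [← not_lt, ← not_lt, ← sub_pos, ← sub_pos (a := entropyTangent b τ),
    entropyTangent_sub_entropyTangent ha hab hb,
    mul_pos_iff_of_pos_right (log_mul_div_mul_pos ha hab hb)]

theorem left_lt_phi (ha : 0 < a) (hab : a < b) (hb : b < 1) : a < phi a b := by
  rw [← not_le, phi_le_iff ha hab hb, not_le, entropyTangent_self]
  exact binEntropy_lt_entropyTangent ⟨ha.trans hab, hb⟩ ⟨ha.le, (hab.trans hb).le⟩ hab.ne'

theorem phi_lt_right (ha : 0 < a) (hab : a < b) (hb : b < 1) : phi a b < b := by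
  rw [← not_le, le_phi_iff ha hab hb, not_le, entropyTangent_self]
  exact binEntropy_lt_entropyTangent ⟨ha, hab.trans hb⟩ ⟨(ha.trans hab).le, hb.le⟩ hab.ne

end Phi

/-! ### Segments -/

theorem sum_mul_div_sum_mem_Icc {ι K : Type*} [Field K] [LinearOrder K] [IsStrictOrderedRing K]
    {S : Finset ι} {w x : ι → K} {a b : K} (hw : ∀ l ∈ S, 0 ≤ w l) (hpos : 0 < ∑ l ∈ S, w l)
    (hx : ∀ l ∈ S, w l ≠ 0 → x l ∈ Set.Icc a b) :
    (∑ l ∈ S, w l * x l) / ∑ l ∈ S, w l ∈ Set.Icc a b := by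
  rw [Set.mem_Icc, le_div_iff₀' hpos, div_le_iff₀' hpos, Finset.sum_mul, Finset.sum_mul]
  refine ⟨Finset.sum_le_sum fun l hl => ?_, Finset.sum_le_sum fun l hl => ?_⟩ <;>
    by_cases h0 : w l = 0
  · simp [h0]
  · exact mul_le_mul_of_nonneg_left (hx l hl h0).1 (hw l hl)
  · simp [h0]
  · exact mul_le_mul_of_nonneg_left (hx l hl h0).2 (hw l hl)

/-- The `g`-moment of the part of the mixture `q` to the left of the splitting pattern
`(i_j, s_j)`, which contains the weight `q_{i_j} - s_j` of the particle `i_j`. -/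
noncomputable def splitMoment (q g : ℕ → ℝ) (i : ℕ → ℕ) (s : ℕ → ℝ) (j : ℕ) : ℝ :=
  ∑ l ∈ Finset.range (i j + 1), q l * g l - s j * g (i j)

/-- The indices `i` and weights `s` cut `∑ q_l B(σ_l)` into `n` segments: the conditions on
splitting patterns that precede those on the compounded particles in `IsPStarPattern`. -/
structure IsSplitting (m n : ℕ) (q : ℕ → ℝ) (i : ℕ → ℕ) (s : ℕ → ℝ) : Prop where
  i_one : i 1 = 0
  s_one : s 1 = 0
  i_last : i (n + 1) = m + 1
  s_last : s (n + 1) = 0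
  i_lt : ∀ j ∈ Finset.Icc 1 n, i j < i (j + 1)
  s_nonneg : ∀ j ∈ Finset.Icc 2 n, 0 ≤ s j
  s_le : ∀ j ∈ Finset.Icc 2 n, s j ≤ q (i j)

section Segment
variable {q σ : ℕ → ℝ} {i : ℕ → ℕ} {s : ℕ → ℝ} {j : ℕ}

theorem sum_segCoeff_mul (g : ℕ → ℝ) (hi : i j < i (j + 1)) :
    ∑ l ∈ Finset.Icc (i j) (i (j + 1)), segCoeff q (i j) (i (j + 1)) (s j) (s (j + 1)) l * g l =
      splitMoment q g i s (j + 1) - splitMoment q g i s j := by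
  have hcoeff (l : ℕ) : segCoeff q (i j) (i (j + 1)) (s j) (s (j + 1)) l * g l = q l * g l -
      (if l = i j then (q l - s j) * g l else 0) -
        if l = i (j + 1) then s (j + 1) * g l else 0 := by
    unfold segCoeff
    split_ifs <;> first | omega | (subst_vars; ring)
  simp only [hcoeff, Finset.sum_sub_distrib, Finset.sum_ite_eq', Finset.left_mem_Icc,
    Finset.right_mem_Icc, hi.le, if_true]
  rw [← Finset.Ico_add_one_right_eq_Icc, Finset.sum_Ico_eq_sub _ (by omega), splitMoment,
    splitMoment, Finset.sum_range_succ _ (i j)]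
  ring

theorem segWeight_eq_sub (hi : i j < i (j + 1)) :
    segWeight q i s j = splitMoment q 1 i s (j + 1) - splitMoment q 1 i s j := by
  simp only [← sum_segCoeff_mul 1 hi, segWeight, Pi.one_apply, mul_one]

theorem segMean_eq_div (hi : i j < i (j + 1)) : segMean q σ i s j =
    (splitMoment q σ i s (j + 1) - splitMoment q σ i s j) / segWeight q i s j := by
  rw [segMean, sum_segCoeff_mul σ hi]

theorem segWeight_mul_segMean (hi : i j < i (j + 1)) (hw : segWeight q i s j ≠ 0) :
    segWeight q i s j * segMean q σ i s j =
      splitMoment q σ i s (j + 1) - splitMoment q σ i s j := by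
  rw [segMean_eq_div hi, mul_div_cancel₀ _ hw]

end Segment

section Splitting
variable {m n : ℕ} {q σ : ℕ → ℝ} {i : ℕ → ℕ} {s : ℕ → ℝ} {j : ℕ}

namespace IsSplitting

theorem strictMonoOn (hs : IsSplitting m n q i s) : StrictMonoOn i (Set.Icc 1 (n + 1)) :=
  strictMonoOn_of_lt_add_one Set.ordConnected_Icc fun j _ hj hj' =>
    hs.i_lt j (Finset.mem_Icc.2 ⟨hj.1, Nat.le_of_lt_succ hj'.2⟩)

theorem one_le (hs : IsSplitting m n q i s) : 1 ≤ n := by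
  by_contra! hn
  have hlast := hs.i_last
  rw [Nat.lt_one_iff.1 hn, zero_add, hs.i_one] at hlast
  omega

theorem i_le (hs : IsSplitting m n q i s) (hj : j ∈ Finset.Icc 1 (n + 1)) : i j ≤ m + 1 := by
  rw [Finset.mem_Icc] at hj
  exact hs.i_last ▸ hs.strictMonoOn.monotoneOn hj ⟨by omega, le_rfl⟩ hj.2

theorem s_mem_Icc (hs : IsSplitting m n q i s) (hN : IsNormalForm m q σ)
    (hj : j ∈ Finset.Icc 1 (n + 1)) : s j ∈ Set.Icc 0 (q (i j)) := by
  by_cases h1 : j = 1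
  · simp [h1, hs.s_one, hs.i_one, hN.q_zero]
  by_cases h2 : j = n + 1
  · simp [h2, hs.s_last, hs.i_last, hN.q_last]
  have hj' : j ∈ Finset.Icc 2 n := by rw [Finset.mem_Icc] at hj ⊢; omega
  exact ⟨hs.s_nonneg j hj', hs.s_le j hj'⟩

theorem sum_segWeight (hs : IsSplitting m n q i s) (hN : IsNormalForm m q σ) :
    ∑ j ∈ Finset.Icc 1 n, segWeight q i s j = 1 := by
  rw [Finset.sum_congr rfl fun j hj => segWeight_eq_sub (hs.i_lt j hj),
    Finset.sum_Icc_sub hs.one_le]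
  simp only [splitMoment, hs.i_one, hs.s_one, hs.i_last, hs.s_last, Pi.one_apply, mul_one, sub_zero]
  rw [← Finset.sum_Ico_eq_sub _ (by omega), zero_add, Finset.sum_Ico_succ_top (by omega),
    hN.q_last, add_zero]
  exact hN.q_sum

theorem segCoeff_mem_Icc (hs : IsSplitting m n q i s) (hN : IsNormalForm m q σ)
    (hj : j ∈ Finset.Icc 1 n) {l : ℕ} (hl : l ≤ i (j + 1)) :
    segCoeff q (i j) (i (j + 1)) (s j) (s (j + 1)) l ∈ Set.Icc 0 (q l) := by
  rw [Finset.mem_Icc] at hj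
  have hj₁ : j ∈ Finset.Icc 1 (n + 1) := Finset.mem_Icc.2 (by omega)
  have hj₂ : j + 1 ∈ Finset.Icc 1 (n + 1) := Finset.mem_Icc.2 (by omega)
  unfold segCoeff
  split_ifs with hleft hright
  · exact hleft ▸ hs.s_mem_Icc hN hj₁
  · have hsj := hs.s_mem_Icc hN hj₂
    rw [hright]
    exact ⟨sub_nonneg.2 hsj.2, sub_le_self _ hsj.1⟩
  · exact ⟨hN.nonneg (hl.trans (hs.i_le hj₂)), le_rfl⟩

theorem segMean_mem_Icc (hs : IsSplitting m n q i s) (hN : IsNormalForm m q σ)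
    (hj : j ∈ Finset.Icc 1 n) (hw : 0 < segWeight q i s j) :
    segMean q σ i s j ∈ Set.Icc (0 : ℝ) (1 / 2) := by
  have hcoeff {l : ℕ} (hl : l ∈ Finset.Icc (i j) (i (j + 1))) :=
    hs.segCoeff_mem_Icc hN hj (Finset.mem_Icc.1 hl).2
  refine sum_mul_div_sum_mem_Icc (fun l hl => (hcoeff hl).1) hw fun l hl h0 => hN.mem_Icc ?_
  have hlast : i (j + 1) ≤ m + 1 := hs.i_le (by rw [Finset.mem_Icc] at hj ⊢; omega)
  by_contra hlm
  have hq := hN.eq_zero ((Finset.mem_Icc.1 hl).2.trans hlast) hlm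
  exact h0 (le_antisymm (hq ▸ (hcoeff hl).2) (hcoeff hl).1)

theorem isBSCMixture (hs : IsSplitting m n q i s) (hN : IsNormalForm m q σ)
    (hw : ∀ j ∈ Finset.Icc 1 n, 0 < segWeight q i s j) :
    IsBSCMixture n (segWeight q i s) (segMean q σ i s) where
  weight_nonneg j hj := (hw j hj).le
  crossover_mem j hj := Set.Icc_subset_Icc_right (by norm_num) (hs.segMean_mem_Icc hN hj (hw j hj))
  sum_weight := hs.sum_segWeight hN

theorem isPStarPattern (hs : IsSplitting m n q i s) (hN : IsNormalForm m q σ)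
    (hw : ∀ j ∈ Finset.Icc 1 n, 0 < segWeight q i s j)
    (hlt : ∀ j ∈ Finset.Ico 1 n, segMean q σ i s j < segMean q σ i s (j + 1))
    (hleft : ∀ j ∈ Finset.Icc 1 n, i (j + 1) = i j + 1 → s j = 0 →
      s (j + 1) = 0 ∧ segWeight q i s j = q (i (j + 1)) ∧ segMean q σ i s j = σ (i (j + 1)))
    (hright : ∀ j ∈ Finset.Icc 1 n, i (j + 1) = i j + 1 → s (j + 1) = q (i (j + 1)) →
      s j = q (i j) ∧ segWeight q i s j = q (i j) ∧ segMean q σ i s j = σ (i j)) :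
    IsPStarPattern m n q σ i s :=
  have hmean (j : ℕ) (hj : j ∈ Finset.Icc 1 n) := hs.segMean_mem_Icc hN hj (hw j hj)
  ⟨hs.i_one, hs.s_one, hs.i_last, hs.s_last, hs.i_lt, hs.s_nonneg, hs.s_le, hw,
    (hmean 1 (Finset.left_mem_Icc.2 hs.one_le)).1, hlt,
    (hmean n (Finset.right_mem_Icc.2 hs.one_le)).2, hleft, hright⟩

end IsSplitting

namespace IsPStarPattern

theorem isSplitting (h : IsPStarPattern m n q σ i s) : IsSplitting m n q i s :=
  ⟨h.i_one, h.s_one, h.i_last, h.s_last, h.i_lt, h.s_nonneg, h.s_le⟩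

theorem isBSCMixture (h : IsPStarPattern m n q σ i s) (hN : IsNormalForm m q σ) :
    IsBSCMixture n (segWeight q i s) (segMean q σ i s) :=
  h.isSplitting.isBSCMixture hN h.weight_pos

theorem isPStarDegradation (h : IsPStarPattern m n q σ i s) (hN : IsNormalForm m q σ) :
    IsPStarDegradation m n q σ (segChannel n q σ i s) :=
  ⟨(h.isBSCMixture hN).isBIDMC, i, s, h, .refl _⟩

theorem segMean_mem_Icc (h : IsPStarPattern m n q σ i s) (hN : IsNormalForm m q σ)
    (hj : j ∈ Finset.Icc 1 n) : segMean q σ i s j ∈ Set.Icc (0 : ℝ) (1 / 2) :=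
  h.isSplitting.segMean_mem_Icc hN hj (h.weight_pos j hj)

theorem segMean_pos (h : IsPStarPattern m n q σ i s) (hN : IsNormalForm m q σ)
    (hj : j ∈ Finset.Ico 1 n) : 0 < segMean q σ i s (j + 1) :=
  (h.segMean_mem_Icc hN (Finset.Ico_subset_Icc_self hj)).1.trans_lt (h.mean_lt j hj)

end IsPStarPattern

theorem IsPPlusDegradation.isPStarDegradation {Y : Type*} {W : ZMod 2 → Y → ℝ}
    (h : IsPPlusDegradation m n q σ W) : IsPStarDegradation m n q σ W :=
  let ⟨hW, i, s, hp, _, he⟩ := h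
  ⟨hW, i, s, hp, he⟩

end Splitting

/-! ### Fractional splitting weights -/

open Filter Topology

section Update
variable {q σ : ℕ → ℝ} {i : ℕ → ℕ} {s : ℕ → ℝ} {j : ℕ} {x : ℝ}

theorem splitMoment_update_self (g : ℕ → ℝ) :
    splitMoment q g i (Function.update s j x) j = splitMoment q g i s j + (s j - x) * g (i j) := by
  rw [splitMoment, splitMoment, Function.update_self]
  ring

theorem splitMoment_update_of_ne {l : ℕ} (g : ℕ → ℝ) (hl : l ≠ j) :
    splitMoment q g i (Function.update s j x) l = splitMoment q g i s l := by
  rw [splitMoment, splitMoment, Function.update_of_ne hl]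

theorem isTransfer_update (hi : i j < i (j + 1)) (hi' : i (j + 1) < i (j + 2))
    (hw₁ : segWeight q i s j ≠ 0) (hw₂ : segWeight q i s (j + 1) ≠ 0)
    (hw₁' : segWeight q i (Function.update s (j + 1) x) j ≠ 0)
    (hw₂' : segWeight q i (Function.update s (j + 1) x) (j + 1) ≠ 0) :
    IsTransfer (segWeight q i s) (segMean q σ i s)
      (segWeight q i (Function.update s (j + 1) x)) (segMean q σ i (Function.update s (j + 1) x))
      j (s (j + 1) - x) (σ (i (j + 1))) where
  weight_left := by
    rw [segWeight_eq_sub hi, segWeight_eq_sub hi, splitMoment_update_self,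
      splitMoment_update_of_ne _ (by omega), Pi.one_apply]
    ring
  weight_right := by
    rw [segWeight_eq_sub hi', segWeight_eq_sub hi', splitMoment_update_self,
      splitMoment_update_of_ne _ (by omega), Pi.one_apply]
    ring
  moment_left := by
    rw [segWeight_mul_segMean hi hw₁, segWeight_mul_segMean hi hw₁', splitMoment_update_self,
      splitMoment_update_of_ne _ (by omega)]
    ring
  moment_right := by
    rw [segWeight_mul_segMean hi' hw₂, segWeight_mul_segMean hi' hw₂', splitMoment_update_self,
      splitMoment_update_of_ne _ (by omega)]
    ring
  weight_of_ne l hl hl' := by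
    rw [segWeight, segWeight, Function.update_of_ne hl', Function.update_of_ne (by omega)]
  crossover_of_ne l hl hl' := by
    rw [segMean, segMean, segWeight, segWeight, Function.update_of_ne hl',
      Function.update_of_ne (by omega)]

end Update

section Perturbation
variable {m n : ℕ} {q σ : ℕ → ℝ} {i : ℕ → ℕ} {s : ℕ → ℝ} {j : ℕ} {x : ℝ}

theorem continuous_segCoeff (l : ℕ) :
    Continuous fun s : ℕ → ℝ => segCoeff q (i j) (i (j + 1)) (s j) (s (j + 1)) l := by
  unfold segCoeff
  split_ifs <;> fun_prop

theorem continuous_segWeight : Continuous fun s => segWeight q i s j :=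
  continuous_finsetSum _ fun l _ => continuous_segCoeff l

theorem continuousAt_segMean (hw : segWeight q i s j ≠ 0) :
    ContinuousAt (fun s => segMean q σ i s j) s :=
  (continuous_finsetSum _ fun l _ => (continuous_segCoeff l).mul_const (σ l)).continuousAt.div
    continuous_segWeight.continuousAt hw

theorem eventually_segWeight_pos (hw : ∀ j ∈ Finset.Icc 1 n, 0 < segWeight q i s j) :
    ∀ᶠ s' in 𝓝 s, ∀ j ∈ Finset.Icc 1 n, 0 < segWeight q i s' j :=
  (Finset.eventually_all _).2 fun j hj =>
    continuous_segWeight.continuousAt.eventually_const_lt (hw j hj)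

theorem eventually_segMean_lt (hw : ∀ j ∈ Finset.Icc 1 n, 0 < segWeight q i s j)
    (hlt : ∀ j ∈ Finset.Ico 1 n, segMean q σ i s j < segMean q σ i s (j + 1)) :
    ∀ᶠ s' in 𝓝 s, ∀ j ∈ Finset.Ico 1 n, segMean q σ i s' j < segMean q σ i s' (j + 1) := by
  refine (Finset.eventually_all _).2 fun j hj => ?_
  have hj' := Finset.mem_Ico.1 hj
  exact (continuousAt_segMean (hw j (Finset.mem_Icc.2 (by omega))).ne').eventually_lt
    (continuousAt_segMean (hw (j + 1) (Finset.mem_Icc.2 (by omega))).ne') (hlt j hj)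

theorem IsSplitting.update (hs : IsSplitting m n q i s) (hj : j ∈ Finset.Icc 2 n)
    (hx : x ∈ Set.Icc 0 (q (i j))) : IsSplitting m n q i (Function.update s j x) where
  i_one := hs.i_one
  s_one := by
    rw [Finset.mem_Icc] at hj
    rw [Function.update_of_ne (by omega), hs.s_one]
  i_last := hs.i_last
  s_last := by
    rw [Finset.mem_Icc] at hj
    rw [Function.update_of_ne (by omega), hs.s_last]
  i_lt := hs.i_lt
  s_nonneg l hl := by
    rcases eq_or_ne l j with rfl | hlj
    · rw [Function.update_self]
      exact hx.1
    · rw [Function.update_of_ne hlj]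
      exact hs.s_nonneg l hl
  s_le l hl := by
    rcases eq_or_ne l j with rfl | hlj
    · rw [Function.update_self]
      exact hx.2
    · rw [Function.update_of_ne hlj]
      exact hs.s_le l hl

namespace IsPStarPattern

-- The adjacency conditions survive because they never apply next to a fractional weight.
theorem update (h : IsPStarPattern m n q σ i s) (hN : IsNormalForm m q σ)
    (hj : j ∈ Finset.Icc 2 n) (hs₀ : s j ≠ 0) (hs₁ : s j ≠ q (i j)) (hx : x ∈ Set.Ioo 0 (q (i j)))
    (hw : ∀ l ∈ Finset.Icc 1 n, 0 < segWeight q i (Function.update s j x) l)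
    (hlt : ∀ l ∈ Finset.Ico 1 n, segMean q σ i (Function.update s j x) l <
      segMean q σ i (Function.update s j x) (l + 1)) :
    IsPStarPattern m n q σ i (Function.update s j x) := by
  refine (h.isSplitting.update hj (Set.Ioo_subset_Icc_self hx)).isPStarPattern hN hw hlt
    (fun l hl hadj hsl => ?_) (fun l hl hadj hsl => ?_)
  · have hlj : l ≠ j := by
      rintro rfl
      exact hx.1.ne' (by simpa only [Function.update_self] using hsl)
    rw [Function.update_of_ne hlj] at hsl
    have hleft := h.adjacent_left l hl hadj hsl
    have hlj' : l + 1 ≠ j := by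
      rintro rfl
      exact hs₀ hleft.1
    simpa only [segMean, segWeight, Function.update_of_ne hlj, Function.update_of_ne hlj']
      using hleft
  · have hlj' : l + 1 ≠ j := by
      rintro rfl
      exact hx.2.ne (by simpa only [Function.update_self] using hsl)
    rw [Function.update_of_ne hlj'] at hsl
    have hright := h.adjacent_right l hl hadj hsl
    have hlj : l ≠ j := by
      rintro rfl
      exact hs₁ hright.1
    simpa only [segMean, segWeight, Function.update_of_ne hlj, Function.update_of_ne hlj']
      using hright

theorem eventually_update (h : IsPStarPattern m n q σ i s) (hN : IsNormalForm m q σ)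
    (hj : j ∈ Finset.Icc 2 n) (hs₀ : s j ≠ 0) (hs₁ : s j ≠ q (i j)) :
    ∀ᶠ x in 𝓝 (s j), IsPStarPattern m n q σ i (Function.update s j x) := by
  have htendsto : Tendsto (Function.update s j) (𝓝 (s j)) (𝓝 s) := by
    simpa using (continuous_const.update j continuous_id).tendsto' (s j) s (by simp)
  filter_upwards [htendsto.eventually (eventually_segWeight_pos h.weight_pos),
    htendsto.eventually (eventually_segMean_lt h.weight_pos h.mean_lt),
    Ioo_mem_nhds ((h.s_nonneg j hj).lt_of_ne' hs₀) ((h.s_le j hj).lt_of_ne hs₁)]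
    with x hw hlt hx
  exact h.update hN hj hs₀ hs₁ hx hw hlt

theorem one_lt_of_ne_zero (h : IsPStarPattern m n q σ i s) (hj : j ∈ Finset.Icc 2 n)
    (hs₀ : s j ≠ 0) : 1 < i j := by
  have hmono := h.isSplitting.strictMonoOn
  rw [Finset.mem_Icc] at hj
  have hi₂ : 0 < i 2 := h.i_one ▸ hmono ⟨le_rfl, by omega⟩ ⟨by omega, by omega⟩ one_lt_two
  rcases hj.1.eq_or_lt with rfl | hj2
  · refine lt_of_le_of_ne hi₂ fun hi => hs₀ ?_
    exact (h.adjacent_left 1 (Finset.mem_Icc.2 (by omega)) (by rw [← hi, h.i_one]) h.s_one).1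
  · exact lt_of_le_of_lt hi₂ (hmono ⟨by omega, by omega⟩ ⟨by omega, by omega⟩ hj2)

theorem segMean_pos_of_fractional (h : IsPStarPattern m n q σ i s) (hN : IsNormalForm m q σ)
    (hj : j ∈ Finset.Ico 1 n) (hs₀ : s (j + 1) ≠ 0) (hs₁ : s (j + 1) ≠ q (i (j + 1))) :
    0 < segMean q σ i s j := by
  have hj' := Finset.mem_Ico.1 hj
  have hj₁ : j ∈ Finset.Icc 1 n := Finset.mem_Icc.2 (by omega)
  have hj₂ : j + 1 ∈ Finset.Icc 2 n := Finset.mem_Icc.2 (by omega)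
  have hlast : i (j + 1) < m + 1 := h.i_last ▸
    h.isSplitting.strictMonoOn ⟨by omega, by omega⟩ ⟨by omega, le_rfl⟩ (by omega)
  have hσ : 0 < σ (i (j + 1)) :=
    hN.pos (Finset.mem_Ioc.2 ⟨h.one_lt_of_ne_zero hj₂ hs₀, by omega⟩)
  have hi := h.i_lt j hj₁
  refine div_pos (Finset.sum_pos' (fun l hl => ?_)
    ⟨i (j + 1), Finset.right_mem_Icc.2 hi.le, mul_pos ?_ hσ⟩) (h.weight_pos j hj₁)
  · have hle := (Finset.mem_Icc.1 hl).2
    have hcoeff := h.isSplitting.segCoeff_mem_Icc hN hj₁ hle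
    by_cases hlm : l ∈ Finset.Icc 1 m
    · exact mul_nonneg hcoeff.1 (hN.mem_Icc hlm).1
    · rw [hN.eq_zero (by omega) hlm] at hcoeff
      rw [le_antisymm hcoeff.2 hcoeff.1, zero_mul]
  · rw [segCoeff, if_neg hi.ne', if_pos rfl]
    exact sub_pos.2 ((h.s_le _ hj₂).lt_of_ne hs₁)

theorem symmCapacity_lt_update (h : IsPStarPattern m n q σ i s) (hN : IsNormalForm m q σ)
    (hj : j ∈ Finset.Ico 1 n) (hx : IsPStarPattern m n q σ i (Function.update s (j + 1) x))
    (hpos : 0 < segMean q σ i s j) (hne : s (j + 1) ≠ x)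
    (hslope : (s (j + 1) - x) * entropyTangent (segMean q σ i s j) (σ (i (j + 1))) ≤
      (s (j + 1) - x) * entropyTangent (segMean q σ i s (j + 1)) (σ (i (j + 1)))) :
    symmCapacity (segChannel n q σ i s) <
      symmCapacity (segChannel n q σ i (Function.update s (j + 1) x)) := by
  have hj' := Finset.mem_Ico.1 hj
  have hj₁ : j ∈ Finset.Icc 1 n := Finset.mem_Icc.2 (by omega)
  have hj₂ : j + 1 ∈ Finset.Icc 1 n := Finset.mem_Icc.2 (by omega)
  have htransfer := isTransfer_update (σ := σ) (h.i_lt j hj₁) (h.i_lt _ hj₂)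
    (h.weight_pos j hj₁).ne' (h.weight_pos _ hj₂).ne'
    (hx.weight_pos j hj₁).ne' (hx.weight_pos _ hj₂).ne'
  exact htransfer.symmCapacity_lt hj (h.isBSCMixture hN) (hx.isBSCMixture hN)
    ⟨hpos, (h.segMean_mem_Icc hN hj₁).2.trans_lt one_half_lt_one⟩
    ⟨h.segMean_pos hN hj, (h.segMean_mem_Icc hN hj₂).2.trans_lt one_half_lt_one⟩
    (h.mean_lt j hj).ne (sub_ne_zero.2 hne) hslope

theorem exists_symmCapacity_lt (h : IsPStarPattern m n q σ i s) (hN : IsNormalForm m q σ)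
    (hj : j ∈ Finset.Ico 1 n) (hs₀ : s (j + 1) ≠ 0) (hs₁ : s (j + 1) ≠ q (i (j + 1))) :
    ∃ s', IsPStarPattern m n q σ i s' ∧
      symmCapacity (segChannel n q σ i s) < symmCapacity (segChannel n q σ i s') := by
  have hj' : j + 1 ∈ Finset.Icc 2 n := by rw [Finset.mem_Ico] at hj; rw [Finset.mem_Icc]; omega
  have hpos := h.segMean_pos_of_fractional hN hj hs₀ hs₁
  have hev := h.eventually_update hN hj' hs₀ hs₁
  rcases le_total (entropyTangent (segMean q σ i s j) (σ (i (j + 1))))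
    (entropyTangent (segMean q σ i s (j + 1)) (σ (i (j + 1)))) with hle | hle
  · obtain ⟨x, hx, hlt⟩ := ((hev.filter_mono nhdsWithin_le_nhds).and
      (self_mem_nhdsWithin (s := Set.Iio (s (j + 1))))).exists
    exact ⟨_, hx, h.symmCapacity_lt_update hN hj hx hpos (ne_of_gt hlt)
      (mul_le_mul_of_nonneg_left hle (sub_nonneg.2 (le_of_lt hlt)))⟩
  · obtain ⟨x, hx, hlt⟩ := ((hev.filter_mono nhdsWithin_le_nhds).and
      (self_mem_nhdsWithin (s := Set.Ioi (s (j + 1))))).exists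
    exact ⟨_, hx, h.symmCapacity_lt_update hN hj hx hpos (ne_of_lt hlt)
      (mul_le_mul_of_nonpos_left hle (sub_nonpos.2 (le_of_lt hlt)))⟩

end IsPStarPattern

theorem IsCOptimal.eq_zero_or_eq {X Y : Type*} {Q : ZMod 2 → X → ℝ} {W : ZMod 2 → Y → ℝ}
    (hW : IsCOptimal m n q σ Q W) (hN : IsNormalForm m q σ) (hQ : 0 < symmCapacity Q)
    (h : IsPStarPattern m n q σ i s) (he : ChannelEquiv W (segChannel n q σ i s))
    (hj : j ∈ Finset.Icc 2 n) : s j = 0 ∨ s j = q (i j) := by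
  rw [Finset.mem_Icc] at hj
  obtain ⟨j, rfl⟩ := Nat.exists_eq_add_of_le' (one_le_two.trans hj.1)
  by_contra! hs
  obtain ⟨s', hs', hlt⟩ :=
    h.exists_symmCapacity_lt hN (Finset.mem_Ico.2 (by omega)) hs.1 hs.2
  rw [← he.symmCapacity_eq hW.1.1 (h.isBSCMixture hN).isBIDMC] at hlt
  exact (hW.2 _ _ (hs'.isPStarDegradation hN)).not_gt ((clr_lt_clr_iff hQ).2 hlt)

end Perturbation

/-! ### Block channels -/

section Adjacent
variable {q σ : ℕ → ℝ} {i : ℕ → ℕ} {j : ℕ}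

theorem segWeight_zero_of_adjacent (hi : i (j + 1) = i j + 1) :
    segWeight q i 0 j = q (i (j + 1)) := by
  rw [segWeight_eq_sub (by omega)]
  simp [splitMoment, hi, Finset.sum_range_succ _ (i j + 1)]

theorem segMean_zero_of_adjacent (hi : i (j + 1) = i j + 1) (hq : q (i (j + 1)) ≠ 0) :
    segMean q σ i 0 j = σ (i (j + 1)) := by
  rw [segMean_eq_div (by omega), segWeight_zero_of_adjacent hi, div_eq_iff hq]
  simp [splitMoment, hi, Finset.sum_range_succ _ (i j + 1), mul_comm]

end Adjacent

/-- The indices `i_j` for which `D_Q(i_2, …, i_n; 0, …, 0) = D⁺_Q(k_1, …, k_{n-1})`: as the particle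
`i_j` belongs to the segment on its left if `s_j = 0`, `i_j` is the last index of a block. -/
def blockIndex (m n : ℕ) (k : ℕ → ℕ) (j : ℕ) : ℕ :=
  if j = n + 1 then m + 1 else k (j - 1) - 1

section Block
variable {m n : ℕ} {q σ : ℕ → ℝ} {k : ℕ → ℕ} {j c a : ℕ} {t : ℝ}

theorem blockWeight_eq_sub (h : k (j - 1) ≤ k j) : blockWeight q k j =
    ∑ l ∈ Finset.range (k j), q l - ∑ l ∈ Finset.range (k (j - 1)), q l :=
  Finset.sum_Ico_eq_sub _ h

theorem blockWeight_mul_blockMean (h : k (j - 1) ≤ k j) (hw : blockWeight q k j ≠ 0) :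
    blockWeight q k j * blockMean q σ k j =
      ∑ l ∈ Finset.range (k j), q l * σ l - ∑ l ∈ Finset.range (k (j - 1)), q l * σ l := by
  rw [blockMean, mul_div_cancel₀ _ hw, Finset.sum_Ico_eq_sub _ h]

namespace IsCutSequence

theorem strictMonoOn (hk : IsCutSequence m n k) : StrictMonoOn k (Set.Iic n) :=
  strictMonoOn_of_lt_add_one Set.ordConnected_Iic fun j _ _ hj =>
    hk.lt (j + 1) (Finset.mem_Icc.2 ⟨by omega, hj⟩)

theorem one_le (hk : IsCutSequence m n k) (hN : IsNormalForm m q σ) : 1 ≤ n := by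
  by_contra! hn
  have hlast := hk.last
  rw [Nat.lt_one_iff.1 hn, hk.zero] at hlast
  have hsum := hN.q_sum
  rw [show m = 0 by omega] at hsum
  exact zero_ne_one hsum

theorem mem_Icc (hk : IsCutSequence m n k) (hj : j ≤ n) : k j ∈ Set.Icc 1 (m + 1) := by
  have hmono := hk.strictMonoOn.monotoneOn
  exact ⟨hk.zero ▸ hmono (Nat.zero_le n) hj (Nat.zero_le j),
    hk.last ▸ hmono hj Set.self_mem_Iic hj⟩

theorem Ico_subset (hk : IsCutSequence m n k) (hj : j ∈ Finset.Icc 1 n) :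
    Finset.Ico (k (j - 1)) (k j) ⊆ Finset.Icc 1 m := by
  rw [Finset.mem_Icc] at hj
  have hleft := (hk.mem_Icc (j := j - 1) (by omega)).1
  have hright := (hk.mem_Icc hj.2).2
  intro l hl
  rw [Finset.mem_Ico] at hl
  exact Finset.mem_Icc.2 (by omega)

theorem blockWeight_pos (hk : IsCutSequence m n k) (hN : IsNormalForm m q σ)
    (hj : j ∈ Finset.Icc 1 n) : 0 < blockWeight q k j :=
  Finset.sum_pos (fun l hl => hN.q_pos l (hk.Ico_subset hj hl)) (Finset.nonempty_Ico.2 (hk.lt j hj))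

theorem blockMean_mem_Icc (hk : IsCutSequence m n k) (hN : IsNormalForm m q σ)
    (hj : j ∈ Finset.Icc 1 n) : blockMean q σ k j ∈ Set.Icc (σ (k (j - 1))) (σ (k j - 1)) := by
  have hblock (l : ℕ) (hl : l ∈ Finset.Ico (k (j - 1)) (k j)) : l ∈ Set.Icc 1 m :=
    Finset.mem_Icc.1 (hk.Ico_subset hj hl)
  have hlt := hk.lt j hj
  have hfirst := hblock (k (j - 1)) (Finset.left_mem_Ico.2 hlt)
  have hlast := hblock (k j - 1) (Finset.mem_Ico.2 (by omega))
  refine sum_mul_div_sum_mem_Icc (fun l hl => (hN.q_pos l (hk.Ico_subset hj hl)).le)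
    (hk.blockWeight_pos hN hj) fun l hl _ => ?_
  have hl' := Finset.mem_Ico.1 hl
  exact ⟨hN.strictMonoOn.monotoneOn hfirst (hblock l hl) hl'.1,
    hN.strictMonoOn.monotoneOn (hblock l hl) hlast (by omega)⟩

theorem blockMean_mem_Icc_half (hk : IsCutSequence m n k) (hN : IsNormalForm m q σ)
    (hj : j ∈ Finset.Icc 1 n) : blockMean q σ k j ∈ Set.Icc (0 : ℝ) (1 / 2) :=
  have hlt := hk.lt j hj
  Set.Icc_subset_Icc (hN.σ_nonneg _ (hk.Ico_subset hj (Finset.left_mem_Ico.2 hlt)))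
    (hN.σ_le _ (hk.Ico_subset hj (Finset.mem_Ico.2 (by omega)))) (hk.blockMean_mem_Icc hN hj)

theorem blockMean_pos (hk : IsCutSequence m n k) (hN : IsNormalForm m q σ)
    (hj : j ∈ Finset.Icc 1 n) (hσ : 0 < σ (k j - 1)) : 0 < blockMean q σ k j := by
  have hlt := hk.lt j hj
  have hlast : k j - 1 ∈ Finset.Ico (k (j - 1)) (k j) := Finset.mem_Ico.2 (by omega)
  refine div_pos (Finset.sum_pos' (fun l hl => ?_)
    ⟨_, hlast, mul_pos (hN.q_pos _ (hk.Ico_subset hj hlast)) hσ⟩) (hk.blockWeight_pos hN hj)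
  have hl' := hk.Ico_subset hj hl
  exact mul_nonneg (hN.q_pos l hl').le (hN.σ_nonneg l hl')

theorem blockMean_lt (hk : IsCutSequence m n k) (hN : IsNormalForm m q σ)
    (hj : j ∈ Finset.Ico 1 n) : blockMean q σ k j < blockMean q σ k (j + 1) := by
  rw [Finset.mem_Ico] at hj
  have hj₁ : j ∈ Finset.Icc 1 n := Finset.mem_Icc.2 (by omega)
  have hj₂ : j + 1 ∈ Finset.Icc 1 n := Finset.mem_Icc.2 (by omega)
  have hlt := hk.lt j hj₁
  have hlast := hk.Ico_subset hj₁ (Finset.mem_Ico.2 ⟨Nat.le_sub_one_of_lt hlt, by omega⟩)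
  have hfirst := hk.Ico_subset hj₂ (Finset.left_mem_Ico.2 (hk.lt _ hj₂))
  calc blockMean q σ k j ≤ σ (k j - 1) := (hk.blockMean_mem_Icc hN hj₁).2
    _ < σ (k j) := hN.strictMonoOn (Finset.mem_Icc.1 hlast) (Finset.mem_Icc.1 hfirst) (by omega)
    _ ≤ blockMean q σ k (j + 1) := (hk.blockMean_mem_Icc hN hj₂).1

theorem blockIndex_lt (hk : IsCutSequence m n k) (hj : j ∈ Finset.Icc 1 n) :
    blockIndex m n k j < blockIndex m n k (j + 1) := by
  have hlt := hk.lt j hj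
  rw [Finset.mem_Icc] at hj
  have hleft := (hk.mem_Icc (j := j - 1) (by omega)).1
  have hright := (hk.mem_Icc hj.2).2
  unfold blockIndex
  rw [if_neg (by omega), Nat.add_sub_cancel]
  split_ifs <;> omega

theorem splitMoment_blockIndex (hk : IsCutSequence m n k) (hN : IsNormalForm m q σ) (g : ℕ → ℝ)
    (hj : j ≤ n) : splitMoment q g (blockIndex m n k) 0 (j + 1) =
      ∑ l ∈ Finset.range (k j), q l * g l := by
  rw [splitMoment, Pi.zero_apply, zero_mul, sub_zero, blockIndex, Nat.add_sub_cancel]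
  split_ifs with hjn
  · rw [Nat.add_right_cancel hjn, hk.last, Finset.sum_range_succ, hN.q_last, zero_mul, add_zero]
  · rw [Nat.sub_add_cancel (hk.mem_Icc hj).1]

theorem segWeight_blockIndex (hk : IsCutSequence m n k) (hN : IsNormalForm m q σ)
    (hj : j ∈ Finset.Icc 1 n) : segWeight q (blockIndex m n k) 0 j = blockWeight q k j := by
  rw [segWeight_eq_sub (hk.blockIndex_lt hj), blockWeight_eq_sub (hk.lt j hj).le]
  rw [Finset.mem_Icc] at hj
  obtain ⟨j, rfl⟩ := Nat.exists_eq_add_of_le' hj.1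
  rw [hk.splitMoment_blockIndex hN 1 hj.2, hk.splitMoment_blockIndex hN 1 (by omega)]
  simp only [Pi.one_apply, mul_one, Nat.add_sub_cancel]

theorem segMean_blockIndex (hk : IsCutSequence m n k) (hN : IsNormalForm m q σ)
    (hj : j ∈ Finset.Icc 1 n) : segMean q σ (blockIndex m n k) 0 j = blockMean q σ k j := by
  rw [segMean_eq_div (hk.blockIndex_lt hj), hk.segWeight_blockIndex hN hj, blockMean,
    Finset.sum_Ico_eq_sub _ (hk.lt j hj).le]
  rw [Finset.mem_Icc] at hj
  obtain ⟨j, rfl⟩ := Nat.exists_eq_add_of_le' hj.1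
  rw [hk.splitMoment_blockIndex hN σ hj.2, hk.splitMoment_blockIndex hN σ (by omega),
    Nat.add_sub_cancel]

theorem isSplitting (hk : IsCutSequence m n k) (hN : IsNormalForm m q σ) :
    IsSplitting m n q (blockIndex m n k) 0 where
  i_one := by
    have hn := hk.one_le hN
    rw [blockIndex, if_neg (by omega), Nat.sub_self, hk.zero]
  s_one := rfl
  i_last := if_pos rfl
  s_last := rfl
  i_lt _ hj := hk.blockIndex_lt hj
  s_nonneg _ _ := le_rfl
  s_le j hj := by
    rw [Finset.mem_Icc] at hj
    rw [blockIndex, if_neg (by omega)]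
    have hright := (hk.mem_Icc (j := j - 1) (by omega)).2
    exact hN.nonneg (by omega)

theorem isPStarPattern (hk : IsCutSequence m n k) (hN : IsNormalForm m q σ) :
    IsPStarPattern m n q σ (blockIndex m n k) 0 := by
  refine (hk.isSplitting hN).isPStarPattern hN (fun j hj => ?_) (fun j hj => ?_)
    (fun j hj hadj _ => ?_) (fun j hj hadj hq => ?_)
  · rw [hk.segWeight_blockIndex hN hj]
    exact hk.blockWeight_pos hN hj
  · have hj' := Finset.mem_Ico.1 hj
    rw [hk.segMean_blockIndex hN (Finset.mem_Icc.2 (by omega)),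
      hk.segMean_blockIndex hN (Finset.mem_Icc.2 (by omega))]
    exact hk.blockMean_lt hN hj
  · have hw := segWeight_zero_of_adjacent (q := q) hadj
    have hq : q (blockIndex m n k (j + 1)) ≠ 0 := by
      rw [← hw, hk.segWeight_blockIndex hN hj]
      exact (hk.blockWeight_pos hN hj).ne'
    exact ⟨rfl, hw, segMean_zero_of_adjacent hadj hq⟩
  · have hpos := hk.blockWeight_pos hN hj
    rw [← hk.segWeight_blockIndex hN hj, segWeight_zero_of_adjacent hadj, ← hq] at hpos
    exact absurd hpos (lt_irrefl 0)

theorem segChannel_blockIndex (hk : IsCutSequence m n k) (hN : IsNormalForm m q σ) :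
    segChannel n q σ (blockIndex m n k) 0 = blockChannel n q σ k :=
  bscMixture_congr (fun _ hj => hk.segWeight_blockIndex hN hj)
    fun _ hj => hk.segMean_blockIndex hN hj

theorem isBSCMixture (hk : IsCutSequence m n k) (hN : IsNormalForm m q σ) :
    IsBSCMixture n (blockWeight q k) (blockMean q σ k) where
  weight_nonneg j hj := (hk.blockWeight_pos hN hj).le
  crossover_mem j hj :=
    Set.Icc_subset_Icc_right one_half_lt_one.le (hk.blockMean_mem_Icc_half hN hj)
  sum_weight := by
    rw [← (hk.isSplitting hN).sum_segWeight hN]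
    exact Finset.sum_congr rfl fun j hj => (hk.segWeight_blockIndex hN hj).symm

theorem isPPlusDegradation (hk : IsCutSequence m n k) (hN : IsNormalForm m q σ) :
    IsPPlusDegradation m n q σ (blockChannel n q σ k) := by
  refine ⟨(hk.isBSCMixture hN).isBIDMC, _, 0, hk.isPStarPattern hN, fun _ _ => .inl rfl, ?_⟩
  rw [hk.segChannel_blockIndex hN]
  exact .refl _

theorem update (hk : IsCutSequence m n k) (hj : j ∈ Finset.Ico 1 n) (hleft : k (j - 1) < c)
    (hright : c < k (j + 1)) : IsCutSequence m n (Function.update k j c) where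
  zero := by
    rw [Finset.mem_Ico] at hj
    rw [Function.update_of_ne (by omega), hk.zero]
  last := by
    rw [Finset.mem_Ico] at hj
    rw [Function.update_of_ne (by omega), hk.last]
  lt l hl := by
    have hlt := hk.lt l hl
    rw [Finset.mem_Icc] at hl
    rcases eq_or_ne l j with rfl | hlj
    · rwa [Function.update_self, Function.update_of_ne (by omega)]
    rcases eq_or_ne l (j + 1) with rfl | hlj'
    · rwa [Nat.add_sub_cancel, Function.update_self, Function.update_of_ne (by omega)]
    · rwa [Function.update_of_ne hlj, Function.update_of_ne (by omega)]

theorem isTransfer_update (hk : IsCutSequence m n k) (hN : IsNormalForm m q σ)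
    (hj : j ∈ Finset.Ico 1 n) (hk' : IsCutSequence m n (Function.update k j c))
    (hc : ∀ g : ℕ → ℝ, ∑ l ∈ Finset.range c, q l * g l =
      ∑ l ∈ Finset.range (k j), q l * g l + t * g a) :
    IsTransfer (blockWeight q k) (blockMean q σ k) (blockWeight q (Function.update k j c))
      (blockMean q σ (Function.update k j c)) j t (σ a) := by
  rw [Finset.mem_Ico] at hj
  have hj₁ : j ∈ Finset.Icc 1 n := Finset.mem_Icc.2 (by omega)
  have hj₂ : j + 1 ∈ Finset.Icc 1 n := Finset.mem_Icc.2 (by omega)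
  have hj_pred : j - 1 ≠ j := by omega
  have hc₁ : ∑ l ∈ Finset.range c, q l = ∑ l ∈ Finset.range (k j), q l + t := by simpa using hc 1
  refine ⟨?_, ?_, ?_, ?_, fun l hl hl' => ?_, fun l hl hl' => ?_⟩
  · rw [blockWeight_eq_sub (hk.lt j hj₁).le, blockWeight_eq_sub (hk'.lt j hj₁).le,
      Function.update_self, Function.update_of_ne hj_pred, hc₁]
    ring
  · rw [blockWeight_eq_sub (hk.lt _ hj₂).le, blockWeight_eq_sub (hk'.lt _ hj₂).le,
      Nat.add_sub_cancel, Function.update_self, Function.update_of_ne (by omega), hc₁]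
    ring
  · rw [blockWeight_mul_blockMean (hk.lt j hj₁).le (hk.blockWeight_pos hN hj₁).ne',
      blockWeight_mul_blockMean (hk'.lt j hj₁).le (hk'.blockWeight_pos hN hj₁).ne',
      Function.update_self, Function.update_of_ne hj_pred, hc σ]
    ring
  · rw [blockWeight_mul_blockMean (hk.lt _ hj₂).le (hk.blockWeight_pos hN hj₂).ne',
      blockWeight_mul_blockMean (hk'.lt _ hj₂).le (hk'.blockWeight_pos hN hj₂).ne',
      Nat.add_sub_cancel, Function.update_self, Function.update_of_ne (by omega), hc σ]
    ring
  · have hl_pred : l - 1 ≠ j := by omega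
    simp only [blockWeight, Function.update_of_ne hl, Function.update_of_ne hl_pred]
  · have hl_pred : l - 1 ≠ j := by omega
    simp only [blockMean, blockWeight, Function.update_of_ne hl, Function.update_of_ne hl_pred]

section Better
variable {X : Type*} {Q : ZMod 2 → X → ℝ}

theorem better_update (hk : IsCutSequence m n k) (hN : IsNormalForm m q σ)
    (hQ : 0 < symmCapacity Q) (hj : j ∈ Finset.Ico 1 n) (hpos : 0 < blockMean q σ k j)
    (hleft : k (j - 1) < c) (hright : c < k (j + 1)) (ht : t ≠ 0)
    (hc : ∀ g : ℕ → ℝ, ∑ l ∈ Finset.range c, q l * g l =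
      ∑ l ∈ Finset.range (k j), q l * g l + t * g a)
    (hslope : t * entropyTangent (blockMean q σ k j) (σ a) ≤
      t * entropyTangent (blockMean q σ k (j + 1)) (σ a)) :
    IsCutSequence m n (Function.update k j c) ∧
      IsPPlusDegradation m n q σ (blockChannel n q σ (Function.update k j c)) ∧
      IsBetter m n q σ Q (blockChannel n q σ (Function.update k j c)) (blockChannel n q σ k) := by
  have hj' := Finset.mem_Ico.1 hj
  have hk' := hk.update hj hleft hright
  have hhalf (l : ℕ) (hl : l ∈ Finset.Icc 1 n) : blockMean q σ k l < 1 :=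
    (hk.blockMean_mem_Icc_half hN hl).2.trans_lt one_half_lt_one
  have hlt := hk.blockMean_lt hN hj
  have hcapacity := (hk.isTransfer_update hN hj hk' hc).symmCapacity_lt hj
    (hk.isBSCMixture hN) (hk'.isBSCMixture hN)
    ⟨hpos, hhalf j (Finset.mem_Icc.2 (by omega))⟩
    ⟨hpos.trans hlt, hhalf (j + 1) (Finset.mem_Icc.2 (by omega))⟩ hlt.ne ht hslope
  exact ⟨hk', hk'.isPPlusDegradation hN, (hk'.isPPlusDegradation hN).isPStarDegradation,
    (hk.isPPlusDegradation hN).isPStarDegradation, (clr_lt_clr_iff hQ).2 hcapacity⟩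

theorem better_add_one_of_le_phi (hk : IsCutSequence m n k) (hN : IsNormalForm m q σ)
    (hQ : 0 < symmCapacity Q) (hj : j ∈ Finset.Ico 1 n)
    (hphi : σ (k j) ≤ phi (blockMean q σ k j) (blockMean q σ k (j + 1))) :
    IsCutSequence m n (Function.update k j (k j + 1)) ∧
      IsPPlusDegradation m n q σ (blockChannel n q σ (Function.update k j (k j + 1))) ∧
      IsBetter m n q σ Q (blockChannel n q σ (Function.update k j (k j + 1)))
        (blockChannel n q σ k) := by
  have hj' := Finset.mem_Ico.1 hj
  have hj₁ : j ∈ Finset.Icc 1 n := Finset.mem_Icc.2 (by omega)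
  have hj₂ : j + 1 ∈ Finset.Icc 1 n := Finset.mem_Icc.2 (by omega)
  have hlt := hk.blockMean_lt hN hj
  have hone := (hk.blockMean_mem_Icc_half hN hj₂).2.trans_lt one_half_lt_one
  have hcut₁ := hk.lt j hj₁
  have hcut₂ := hk.lt (j + 1) hj₂
  have hfirst := (hk.mem_Icc (j := j - 1) (by omega)).1
  have hkj := Finset.mem_Icc.1 (hk.Ico_subset hj₂ (Finset.left_mem_Ico.2 hcut₂))
  rw [Nat.add_sub_cancel] at hcut₂ hkj
  have hq : 0 < q (k j) := hN.q_pos _ (Finset.mem_Icc.2 hkj)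
  have hpos : 0 < blockMean q σ k j := by
    refine (hk.blockMean_mem_Icc_half hN hj₁).1.lt_of_ne fun h0 => ?_
    rw [← h0, phi_zero_left] at hphi
    exact hphi.not_gt (hN.pos (Finset.mem_Ioc.2 (by omega)))
  have hright : k j + 1 < k (j + 1) := by
    refine lt_of_le_of_ne hcut₂ fun heq => (phi_lt_right hpos hlt hone).not_ge (le_trans ?_ hphi)
    simpa only [← heq, Nat.add_sub_cancel] using (hk.blockMean_mem_Icc hN hj₂).2
  refine hk.better_update hN hQ hj hpos (by omega) hright hq.ne'
    (fun g => Finset.sum_range_succ _ _) ?_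
  exact mul_le_mul_of_nonneg_left ((le_phi_iff hpos hlt hone).1 hphi) hq.le

theorem better_sub_one_of_phi_le (hk : IsCutSequence m n k) (hN : IsNormalForm m q σ)
    (hQ : 0 < symmCapacity Q) (hj : j ∈ Finset.Ico 1 n)
    (hphi : phi (blockMean q σ k j) (blockMean q σ k (j + 1)) ≤ σ (k j - 1))
    (hsum : 0 < blockMean q σ k j + σ (k j - 1)) :
    IsCutSequence m n (Function.update k j (k j - 1)) ∧
      IsPPlusDegradation m n q σ (blockChannel n q σ (Function.update k j (k j - 1))) ∧
      IsBetter m n q σ Q (blockChannel n q σ (Function.update k j (k j - 1)))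
        (blockChannel n q σ k) := by
  have hj' := Finset.mem_Ico.1 hj
  have hj₁ : j ∈ Finset.Icc 1 n := Finset.mem_Icc.2 (by omega)
  have hj₂ : j + 1 ∈ Finset.Icc 1 n := Finset.mem_Icc.2 (by omega)
  have hlt := hk.blockMean_lt hN hj
  have hone := (hk.blockMean_mem_Icc_half hN hj₂).2.trans_lt one_half_lt_one
  have hcut₁ := hk.lt j hj₁
  have hcut₂ := hk.lt (j + 1) hj₂
  rw [Nat.add_sub_cancel] at hcut₂
  have hkj := hk.Ico_subset hj₁ (Finset.mem_Ico.2 ⟨Nat.le_sub_one_of_lt hcut₁, by omega⟩)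
  have hq : 0 < q (k j - 1) := hN.q_pos _ hkj
  have hpos : 0 < blockMean q σ k j := by
    have hle := (hk.blockMean_mem_Icc hN hj₁).2
    exact hk.blockMean_pos hN hj₁ (by linarith)
  have hleft : k (j - 1) < k j - 1 := by
    refine lt_of_le_of_ne (by omega) fun heq => (left_lt_phi hpos hlt hone).not_ge (hphi.trans ?_)
    simpa only [heq] using (hk.blockMean_mem_Icc hN hj₁).1
  have hsucc : k j - 1 + 1 = k j := Nat.sub_add_cancel (by omega)
  refine hk.better_update (a := k j - 1) hN hQ hj hpos hleft (by omega) (neg_ne_zero.2 hq.ne')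
    (fun g => ?_) ?_
  · have hrange := Finset.sum_range_succ (fun l => q l * g l) (k j - 1)
    rw [hsucc] at hrange
    rw [hrange]
    ring
  · exact mul_le_mul_of_nonpos_left ((phi_le_iff hpos hlt hone).1 hphi) (neg_nonpos.2 hq.le)

end Better

end IsCutSequence

end Block

end SymBIDMC

theorem corollary3 (m n : ℕ) (hn : 2 ≤ n) (hnm : n < m) (q σ : ℕ → ℝ)
    (hqσ : SymBIDMC.IsNormalForm m q σ)
    {X : Type*} (Q : ZMod 2 → X → ℝ) (hQ : SymBIDMC.IsBIDMC Q)
    (hQe : SymBIDMC.ChannelEquiv Q (SymBIDMC.bscMixture m q σ)) :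
    (∀ (Y : Type*) (W : ZMod 2 → Y → ℝ), SymBIDMC.IsCOptimal m n q σ Q W →
      SymBIDMC.IsPPlusDegradation m n q σ W ∧
      ∀ (i : ℕ → ℕ) (s : ℕ → ℝ), SymBIDMC.IsPStarPattern m n q σ i s →
        SymBIDMC.ChannelEquiv W (SymBIDMC.segChannel n q σ i s) →
        ∀ j ∈ Finset.Icc 2 n, s j = 0 ∨ s j = q (i j)) ∧
    (∀ k : ℕ → ℕ, SymBIDMC.IsCutSequence m n k → ∀ j ∈ Finset.Ico 1 n,
      (σ (k j) ≤ SymBIDMC.phi (SymBIDMC.blockMean q σ k j) (SymBIDMC.blockMean q σ k (j + 1)) →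
        SymBIDMC.IsCutSequence m n (Function.update k j (k j + 1)) ∧
        SymBIDMC.IsPPlusDegradation m n q σ
          (SymBIDMC.blockChannel n q σ (Function.update k j (k j + 1))) ∧
        SymBIDMC.IsBetter m n q σ Q
          (SymBIDMC.blockChannel n q σ (Function.update k j (k j + 1)))
          (SymBIDMC.blockChannel n q σ k)) ∧
      (SymBIDMC.phi (SymBIDMC.blockMean q σ k j) (SymBIDMC.blockMean q σ k (j + 1))
            ≤ σ (k j - 1) →
        0 < SymBIDMC.blockMean q σ k j + σ (k j - 1) →
        SymBIDMC.IsCutSequence m n (Function.update k j (k j - 1)) ∧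
        SymBIDMC.IsPPlusDegradation m n q σ
          (SymBIDMC.blockChannel n q σ (Function.update k j (k j - 1))) ∧
        SymBIDMC.IsBetter m n q σ Q
          (SymBIDMC.blockChannel n q σ (Function.update k j (k j - 1)))
          (SymBIDMC.blockChannel n q σ k))) := by
  have hpos : 0 < SymBIDMC.symmCapacity Q := by
    rw [hQe.symmCapacity_eq hQ hqσ.isBSCMixture.isBIDMC]
    exact hqσ.symmCapacity_pos (by omega)
  refine ⟨fun Y W hW => ?_, fun k hk j hj =>
    ⟨hk.better_add_one_of_le_phi hqσ hpos hj, hk.better_sub_one_of_phi_le hqσ hpos hj⟩⟩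
  have hsplit : ∀ (i : ℕ → ℕ) (s : ℕ → ℝ), SymBIDMC.IsPStarPattern m n q σ i s →
      SymBIDMC.ChannelEquiv W (SymBIDMC.segChannel n q σ i s) →
      ∀ j ∈ Finset.Icc 2 n, s j = 0 ∨ s j = q (i j) :=
    fun i s hp he j hj => hW.eq_zero_or_eq hqσ hpos hp he hj
  obtain ⟨hB, i, s, hp, he⟩ := hW.1
  exact ⟨⟨hB, i, s, hp, hsplit i s hp he, he⟩, hsplit⟩
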